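/- Let $n\ge 1$ be an integer and let $T$ be a real distribution on the unit circle $S^1$ which \emph{almost changes its sign for $2n$ times}: there is a real function $g_0\in C^\infty(S^1)$ having exactly $2n$ zeros, counted with multiplicity, such that $T(g_0f)\ge 0$ for every smooth $f\ge 0$. Let $u(re^{i\theta})=T(P_r(\theta-\cdot))$, with $P_r(\theta)=\frac1{2\pi}\frac{1-r^2}{1-2r\cos\theta+r^2}$, be its Poisson extension to the unit disc $B_1(0)$, and assume that exactly $n$ nodal curves of $u$ intersect at $0$ (near $0$, the set $\{u=0\}$ is the union of $n$ regular analytic arcs through $0$, any two of which meet only at $0$). Suppose that $u$ is an extremer of the curvature estimate, i.e. some nodal curve $\gamma$ of $u$ through $0$ has curvature at $0$ satisfying $$|\kappa(u)|_\gamma(0)|=\frac{4(n+1)}{n}\ \text{ if } n \text{ is odd},\qquad |\kappa(u)|_\gamma(0)|=\frac{4(n+1)}{n}\cos\frac{\pi}{2(n+1)}\ \text{ if } n \text{ is even}.$$ Then there are a real constant $c\neq0$ and a rotation angle $\alpha\in\mathbb R$ such that $c\,u(e^{i\alpha}z)=\operatorname{Re}w(z)$ for all $|z|<1$, where $$w(z)=\frac{z^n}{(1-e^{-i\varphi_0}z)^{2n}}+\frac{2z^{n+1}}{(1-e^{-i\varphi_0}z)^{2n+1}}\,e^{-i(n+1)\varphi_0}\cos(n\varphi_0),\qquad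 \varphi_0=\frac{k\pi}{n}+\frac{l\,\pi}{2n(n+1)},$$ for some integer $0\le k\le n-1$, with $l=0$ if $n$ is odd and $l\in\{1,-1\}$ if $n$ is even (the two signs correspond to each other under the reflection $z\mapsto\bar z$). Equivalently, in terms of the distribution, the correspondingly rotated and scaled distribution $T'(f)=c\,T(f(\cdot-\alpha))$ is $$T'=\sum_{j=1}^{2n}b_jD^j\delta_{\varphi_0},\qquad b_j\in\mathbb R,\qquad \frac1\pi\sum_{j=1}^{2n}b_j(im)^je^{-im\varphi_0}=\begin{cases}0,&1\le m\le n-1,\\ 1,&m=n,\end{cases}$$ where $(D^j\delta_{\varphi_0})(f)=(-1)^jf^{(j)}(\varphi_0)$. -/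

import Mathlib

open Filter Topology
open scoped ContDiff

noncomputable section

/-- Real-valued smooth functions on the unit circle, seen as smooth `2π`-periodic functions
of the angle. -/
def SmoothCircle : Subalgebra ℝ (ℝ → ℝ) where
  carrier := {f | ContDiff ℝ ∞ f ∧ Function.Periodic f (2 * Real.pi)}
  mul_mem' hf hg := ⟨hf.1.mul hg.1, hf.2.mul hg.2⟩
  add_mem' hf hg := ⟨hf.1.add hg.1, hf.2.add hg.2⟩
  algebraMap_mem' _ := ⟨contDiff_const, fun _ => rfl⟩

/-- Real distributions on the circle: linear functionals on smooth functions which are continuous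
for the seminorms `sup |f^(j)|`, that is, bounded by finitely many of them. -/
structure CircleDistribution where
  toLinearMap : SmoothCircle →ₗ[ℝ] ℝ
  bounded' : ∃ (N : ℕ) (C : ℝ), ∀ (f : SmoothCircle) (M : ℝ),
    (∀ j ≤ N, ∀ θ : ℝ, |iteratedDeriv j (f : ℝ → ℝ) θ| ≤ M) → |toLinearMap f| ≤ C * M

instance : CoeFun CircleDistribution (fun _ => SmoothCircle → ℝ) := ⟨fun T => T.toLinearMap⟩

/-- The smooth function `g` has, on the circle (angles in `[0, 2π)`), exactly `N` zeros counted
with multiplicity; the multiplicity of a zero is the order of the first non-vanishing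
derivative. -/
def HasZerosWithMultiplicity (g : ℝ → ℝ) (N : ℕ) : Prop :=
  ∃ (s : Finset ℝ) (m : ℝ → ℕ),
    (∀ θ : ℝ, θ ∈ s ↔ θ ∈ Set.Ico 0 (2 * Real.pi) ∧ g θ = 0) ∧
    (∀ θ ∈ s, (∀ j < m θ, iteratedDeriv j g θ = 0) ∧ iteratedDeriv (m θ) g θ ≠ 0) ∧
    ∑ θ ∈ s, m θ = N

/-- The distribution `T` almost changes its sign for `N` times on the circle. -/
def AlmostChangesSign (T : CircleDistribution) (N : ℕ) : Prop :=
  ∃ g₀ : SmoothCircle, HasZerosWithMultiplicity (g₀ : ℝ → ℝ) N ∧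
    ∀ f : SmoothCircle, (∀ θ : ℝ, 0 ≤ (f : ℝ → ℝ) θ) → 0 ≤ T (g₀ * f)

/-- The Poisson kernel of the unit disc. -/
def diskPoissonKernel (r θ : ℝ) : ℝ :=
  1 / (2 * Real.pi) * ((1 - r ^ 2) / (1 - 2 * r * Real.cos θ + r ^ 2))

theorem diskPoissonKernel_denom_pos {r : ℝ} (h0 : 0 ≤ r) (h1 : r < 1) (θ : ℝ) :
    0 < 1 - 2 * r * Real.cos θ + r ^ 2 := by
  nlinarith [Real.cos_le_one θ, mul_nonneg h0 (sub_nonneg.2 (Real.cos_le_one θ)),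
    pow_pos (sub_pos.2 h1) 2]

/-- For `z = r e^{iθ}` in the open unit disc, the test function `α ↦ P(r, θ - α)`. -/
def poissonTest (z : ℂ) (hz : ‖z‖ < 1) : SmoothCircle :=
  ⟨fun α => diskPoissonKernel ‖z‖ (z.arg - α), by
    constructor
    · unfold diskPoissonKernel
      refine contDiff_const.mul (contDiff_const.div ?_ fun α =>
        (diskPoissonKernel_denom_pos (norm_nonneg z) hz _).ne')
      exact (contDiff_const.sub (contDiff_const.mul
        (Real.contDiff_cos.comp (contDiff_const.sub contDiff_id)))).add contDiff_const
    · intro α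
      simp only [diskPoissonKernel]
      rw [← sub_sub, Real.cos_sub_two_pi]⟩

open Classical in
/-- The Poisson extension `u(r e^{iθ}) = T(P(r, θ - ·))` of `T` to the open unit disc
(given the value `0` elsewhere). -/
def poissonExtension (T : CircleDistribution) (z : ℂ) : ℝ :=
  if hz : ‖z‖ < 1 then T (poissonTest z hz) else 0

/-- `γ` parametrizes, near `γ 0 = p`, an analytic regular arc contained in the nodal set
of `u`: an arc of a nodal curve of `u` through `p`. -/
def IsNodalArc (u : ℂ → ℝ) (p : ℂ) (γ : ℝ → ℂ) : Prop :=
  γ 0 = p ∧ AnalyticAt ℝ γ 0 ∧ deriv γ 0 ≠ 0 ∧ ∀ᶠ t in 𝓝 (0 : ℝ), u (γ t) = 0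

/-- Exactly `n` nodal curves of `u` intersect at `p`: near `p` the nodal set of `u` is the union
of `n` analytic regular arcs through `p`, any two of which meet only at `p`. -/
def NodalCurvesIntersectAt (u : ℂ → ℝ) (p : ℂ) (n : ℕ) : Prop :=
  ∃ γ : Fin n → ℝ → ℂ, (∀ i, IsNodalArc u p (γ i)) ∧
    (∀ i j, i ≠ j → ∃ N ∈ 𝓝 (0 : ℝ), γ i '' N ∩ γ j '' N ⊆ {p}) ∧
    ∀ N ∈ 𝓝 (0 : ℝ), ∀ᶠ z in 𝓝 p, u z = 0 → ∃ i, z ∈ γ i '' N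

/-- The signed curvature `(x' y'' - y' x'') / |γ'|^3` of a plane curve. -/
def planeCurvature (γ : ℝ → ℂ) (t : ℝ) : ℝ :=
  ((deriv γ t).re * (deriv (deriv γ) t).im - (deriv γ t).im * (deriv (deriv γ) t).re)
    / ‖deriv γ t‖ ^ 3

/-- The sharp bound for the curvature at `0` of the `n` nodal curves meeting there, in the
unit disc. -/
def curvatureBound (n : ℕ) : ℝ :=
  if Even n then 4 * (n + 1) / n * Real.cos (Real.pi / (2 * (n + 1))) else 4 * (n + 1) / n

/-- `u` attains equality in the curvature estimate: some nodal curve of `u` through `0` has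
curvature at `0` of absolute value equal to the bound. -/
def IsCurvatureExtremer (u : ℂ → ℝ) (n : ℕ) : Prop :=
  ∃ γ : ℝ → ℂ, IsNodalArc u 0 γ ∧ |planeCurvature γ 0| = curvatureBound n

/-- The holomorphic function whose real part is the extremal harmonic function. -/
def extremalFunction (n : ℕ) (φ : ℝ) (z : ℂ) : ℂ :=
  z ^ n / (1 - Complex.exp (-(Complex.I * φ)) * z) ^ (2 * n)
    + 2 * z ^ (n + 1) / (1 - Complex.exp (-(Complex.I * φ)) * z) ^ (2 * n + 1)
      * Complex.exp (-(Complex.I * (n + 1) * φ)) * Complex.cos (n * φ)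

/-- The translation `f ↦ f(· + α)` of functions on the circle. -/
def circleTranslate (α : ℝ) : SmoothCircle →ₗ[ℝ] SmoothCircle where
  toFun f := ⟨fun θ => (f : ℝ → ℝ) (θ + α),
    f.2.1.comp (contDiff_id.add contDiff_const), fun θ => by
      show (f : ℝ → ℝ) (θ + 2 * Real.pi + α) = (f : ℝ → ℝ) (θ + α)
      rw [add_right_comm]; exact f.2.2 _⟩
  map_add' _ _ := rfl
  map_smul' _ _ := rfl

/-- The `j`-th distributional derivative of the Dirac mass at the angle `φ`:
`(D^j δ_φ)(f) = (-1)^j f^(j)(φ)`. -/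
def diracDeriv (j : ℕ) (φ : ℝ) : SmoothCircle →ₗ[ℝ] ℝ where
  toFun f := (-1) ^ j * iteratedDeriv j (f : ℝ → ℝ) φ
  map_add' f g := by
    have hf : ContDiffAt ℝ j (f : ℝ → ℝ) φ := (f.2.1.of_le (by exact_mod_cast le_top)).contDiffAt
    have hg : ContDiffAt ℝ j (g : ℝ → ℝ) φ := (g.2.1.of_le (by exact_mod_cast le_top)).contDiffAt
    rw [← mul_add, ← iteratedDeriv_add hf hg]; rfl
  map_smul' c f := by
    have hf : ContDiffAt ℝ j (f : ℝ → ℝ) φ := (f.2.1.of_le (by exact_mod_cast le_top)).contDiffAt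
    have h : iteratedDeriv j (c • (f : ℝ → ℝ)) φ = c • iteratedDeriv j (f : ℝ → ℝ) φ :=
      iteratedDeriv_const_smul hf c
    show (-1) ^ j * iteratedDeriv j (c • (f : ℝ → ℝ)) φ = c * _
    rw [h, smul_eq_mul]; ring

end

/-! Dividing out its zeros turns `T` into a positive functional. A trigonometric polynomial `p` of
degree n with the zeros of g₀ is g₀ times a smooth nonvanishing function, so, after a choice of
sign, `T (p * f) ≥ 0` for every f ≥ 0 (`AlmostChangesSign.exists_trigPolynomial`).

Let t_k be the Fourier coefficients of `T`. Near a zero of order m of a holomorphic function, a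
local coordinate turns its real part into Re z^m, whose nodal set has only m tangent lines at 0.
Since n arcs meet at 0, t_k = 0 for |k| < n, and u = Re(z^n H) with H(0) = t_n/π and H'(0) =
t_{n+1}/π. Positivity of pT excludes t_n = 0, which would make all t_k vanish. Expanding u along a
nodal arc gives a unit tangent v with Re(t_n v^n) = 0 and Im(v t_{n+1}/t_n) = (n/2)|κ|
(`IsNodalArc.exists_tangent`).

As p has degree n, T(p) and T(p e^{ix}) involve only t_n, t_{n+1} and the sum of the roots of p.
Testing positivity on 1 - cos(x - φ), for φ adapted to v, bounds (n/2)|κ| by the sum of the real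
parts of 2n + 2 unit numbers with product (-1)^(n+1). That sum is at most 2n + 2 for n odd and (2n +
2) cos(π/(2n + 2)) for n even, which is the curvature bound. For an extremer both estimates are
equalities: all the unit numbers agree (`eq_exp_of_curvatureBound_le`), hence all roots of p
coincide at e^{iφ}, and pT annihilates 1 - cos(x - φ), hence is the point mass T(p) δ_φ
(`IsTrigMultiplier.exists_of_extremal`, `IsTrigMultiplier.apply_mul_eq`).

Applied to the Cauchy kernel, pT = T(p) δ_φ yields the rational function w
(`IsTrigMultiplier.eval_mul_tail`). Applied to smooth multiples of p, it shows that `T` sees only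
the derivatives of order at most 2n at φ. A rotation and a real factor give the normal form. -/

/-! ### Smooth division by zeros of finite order -/

/-- The weighted average `∫₀¹ t^k g(φ + t (x - φ)) dt` of `g` along the segment from `φ` to `x`. -/
noncomputable def segmentMoment (k : ℕ) (g : ℝ → ℝ) (φ x : ℝ) : ℝ :=
  ∫ t in (0 : ℝ)..1, t ^ k * g (φ + t * (x - φ))

/-- The chain rule produces a factor t under the integral. Carrying the weight t^k therefore makes
the family closed under differentiation, which gives smoothness and all the derivatives at φ at
once. -/
theorem hasDerivAt_segmentMoment (k : ℕ) {g : ℝ → ℝ} (hg : ContDiff ℝ ∞ g) (φ x : ℝ) :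
    HasDerivAt (segmentMoment k g φ) (segmentMoment (k + 1) (deriv g) φ x) x := by
  have hg' : Continuous (deriv g) := hg.continuous_deriv (by simp)
  have hc : Continuous fun q : ℝ × ℝ => q.2 ^ (k + 1) * deriv g (φ + q.2 * (q.1 - φ)) := by
    fun_prop
  obtain ⟨C, hC⟩ := ((isCompact_closedBall x 1).prod
    (isCompact_Icc (a := (0 : ℝ)) (b := 1))).exists_bound_of_continuousOn hc.continuousOn
  have hgc := hg.continuous
  refine (intervalIntegral.hasDerivAt_integral_of_dominated_loc_of_deriv_le
    (F := fun x t => t ^ k * g (φ + t * (x - φ)))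
    (F' := fun x t => t ^ (k + 1) * deriv g (φ + t * (x - φ))) (bound := fun _ => C)
    (Metric.closedBall_mem_nhds x one_pos) (Eventually.of_forall fun y => ?_) ?_ ?_ ?_ ?_ ?_).2
  · exact Continuous.aestronglyMeasurable (by fun_prop)
  · exact Continuous.intervalIntegrable (by fun_prop) _ _
  · exact Continuous.aestronglyMeasurable (by fun_prop)
  · refine Eventually.of_forall fun t ht y hy => hC (y, t) ⟨hy, ?_⟩
    rw [Set.uIoc_of_le zero_le_one] at ht
    exact ⟨ht.1.le, ht.2⟩
  · exact intervalIntegrable_const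
  · refine Eventually.of_forall fun t _ y _ => ?_
    have h1 : HasDerivAt (fun y => φ + t * (y - φ)) t y := by
      simpa using (((hasDerivAt_id y).sub_const φ).const_mul t).const_add φ
    have h2 := ((hg.differentiable (by simp)) (φ + t * (y - φ))).hasDerivAt.comp y h1
    convert! h2.const_mul (t ^ k) using 1
    ring

theorem iteratedDeriv_segmentMoment (k j : ℕ) {g : ℝ → ℝ} (hg : ContDiff ℝ ∞ g) (φ : ℝ) :
    iteratedDeriv j (segmentMoment k g φ) = segmentMoment (k + j) (iteratedDeriv j g) φ := by
  induction j with
  | zero => simp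
  | succ j ih =>
    rw [iteratedDeriv_succ, ih, iteratedDeriv_succ]
    have hj : ContDiff ℝ ∞ (iteratedDeriv j g) := by
      rw [iteratedDeriv_eq_iterate]; exact hg.iterate_deriv j
    exact funext fun x => (hasDerivAt_segmentMoment (k + j) hj φ x).deriv

theorem contDiff_segmentMoment (k : ℕ) {g : ℝ → ℝ} (hg : ContDiff ℝ ∞ g) (φ : ℝ) :
    ContDiff ℝ ∞ (segmentMoment k g φ) := by
  refine contDiff_of_differentiable_iteratedDeriv fun j _ => ?_
  rw [iteratedDeriv_segmentMoment k j hg]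
  have hj : ContDiff ℝ ∞ (iteratedDeriv j g) := by
    rw [iteratedDeriv_eq_iterate]; exact hg.iterate_deriv j
  exact fun x => (hasDerivAt_segmentMoment (k + j) hj φ x).differentiableAt

theorem segmentMoment_self (k : ℕ) (g : ℝ → ℝ) (φ : ℝ) :
    segmentMoment k g φ φ = g φ / (k + 1) := by
  simp [segmentMoment, intervalIntegral.integral_mul_const, integral_pow]
  ring

theorem eq_add_mul_segmentMoment {f : ℝ → ℝ} (hf : ContDiff ℝ ∞ f) (φ x : ℝ) :
    f x = f φ + (x - φ) * segmentMoment 0 (deriv f) φ x := by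
  have hg' : Continuous (deriv f) := hf.continuous_deriv (by simp)
  have h := intervalIntegral.integral_eq_sub_of_hasDerivAt (a := 0) (b := 1)
    (f := fun t : ℝ => f (φ + t * (x - φ))) (f' := fun t => (x - φ) * deriv f (φ + t * (x - φ)))
    (fun t _ => by
      have h1 : HasDerivAt (fun t : ℝ => φ + t * (x - φ)) (x - φ) t := by
        simpa using ((hasDerivAt_id t).mul_const (x - φ)).const_add φ
      have h2 := ((hf.differentiable (by simp)) (φ + t * (x - φ))).hasDerivAt.comp t h1
      convert! h2 using 1
      ring)
    (Continuous.intervalIntegrable (by fun_prop) _ _)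
  rw [intervalIntegral.integral_const_mul] at h
  simp only [segmentMoment, pow_zero, one_mul]
  rw [h]; simp

/-- Hadamard's lemma: a smooth function whose derivatives of order less than `m` vanish at `φ` is
`(x - φ)^m` times a smooth function. -/
theorem exists_contDiff_eq_pow_mul (m : ℕ) : ∀ {f : ℝ → ℝ} (_ : ContDiff ℝ ∞ f) {φ : ℝ}
    (_ : ∀ j < m, iteratedDeriv j f φ = 0), ∃ F : ℝ → ℝ, ContDiff ℝ ∞ F ∧
      (∀ x, f x = (x - φ) ^ m * F x) ∧ F φ = iteratedDeriv m f φ / m.factorial := by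
  induction m with
  | zero => exact fun {f} hf φ _ => ⟨f, hf, by simp, by simp⟩
  | succ m ih =>
    intro f hf φ h
    have hf' : ContDiff ℝ ∞ (deriv f) := (contDiff_infty_iff_deriv.1 hf).2
    have key : ∀ j, iteratedDeriv j (segmentMoment 0 (deriv f) φ) φ
        = iteratedDeriv (j + 1) f φ / (j + 1) := fun j => by
      rw [iteratedDeriv_segmentMoment 0 j hf', segmentMoment_self, iteratedDeriv_succ']
      simp
    obtain ⟨F, hF, hFe, hF0⟩ := ih (contDiff_segmentMoment 0 hf' φ) (φ := φ) fun j hj => by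
      rw [key, h (j + 1) (by omega), zero_div]
    refine ⟨F, hF, fun x => ?_, ?_⟩
    · have h0 := h 0 (by omega)
      rw [iteratedDeriv_zero] at h0
      rw [eq_add_mul_segmentMoment hf φ x, hFe, h0]; ring
    · rw [hF0, key, Nat.factorial_succ]; push_cast; field_simp

/-- Near `x₀`, the functions `f` and `p` are a common power of `x - x₀` times smooth functions
whose quotient at `x₀` is `c`. -/
def HasLocalQuotient (f p : ℝ → ℝ) (x₀ c : ℝ) : Prop :=
  ∃ (m : ℕ) (F P : ℝ → ℝ), ContDiff ℝ ∞ F ∧ ContDiff ℝ ∞ P ∧ (∀ x, f x = (x - x₀) ^ m * F x) ∧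
    (∀ x, p x = (x - x₀) ^ m * P x) ∧ P x₀ ≠ 0 ∧ F x₀ / P x₀ = c

theorem hasLocalQuotient_of_ne_zero {f p : ℝ → ℝ} (hf : ContDiff ℝ ∞ f) (hp : ContDiff ℝ ∞ p)
    {x₀ : ℝ} (h : p x₀ ≠ 0) : HasLocalQuotient f p x₀ (f x₀ / p x₀) :=
  ⟨0, f, p, hf, hp, by simp, by simp, h, rfl⟩

theorem HasLocalQuotient.translate {f p : ℝ → ℝ} {x₀ c a : ℝ} (hf : f.Periodic a)
    (hp : p.Periodic a) (h : HasLocalQuotient f p x₀ c) : HasLocalQuotient f p (x₀ + a) c := by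
  obtain ⟨m, F, P, hF, hP, hfe, hpe, h0, hc⟩ := h
  refine ⟨m, fun x => F (x - a), fun x => P (x - a), hF.comp (contDiff_id.sub contDiff_const),
    hP.comp (contDiff_id.sub contDiff_const), fun x => ?_, fun x => ?_, by simpa, by simpa⟩
  · rw [← hf.sub_eq, hfe]; ring
  · rw [← hp.sub_eq, hpe]; ring

/-- The quotient `f / p`, extended by continuity to the zeros of `p`. -/
noncomputable def extendedQuotient (f p : ℝ → ℝ) (x : ℝ) : ℝ :=
  limUnder (𝓝[≠] x) fun y => f y / p y

/-- The punctured limit equals F/P at every point of a neighbourhood of x₀, not only at x₀, so the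
extended quotient inherits the smoothness of F/P. -/
theorem HasLocalQuotient.exists_contDiffAt {f p : ℝ → ℝ} {x₀ c : ℝ}
    (h : HasLocalQuotient f p x₀ c) :
    ContDiffAt ℝ ∞ (extendedQuotient f p) x₀ ∧ extendedQuotient f p x₀ = c := by
  obtain ⟨m, F, P, hF, hP, hfe, hpe, h0, hc⟩ := h
  have hne : ∀ᶠ y in 𝓝 x₀, P y ≠ 0 := hP.continuous.continuousAt.eventually_ne h0
  have key : ∀ᶠ y in 𝓝 x₀, extendedQuotient f p y = F y / P y := by
    filter_upwards [hne] with y hy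
    refine Tendsto.limUnder_eq ?_
    have hc : Tendsto (fun w => F w / P w) (𝓝[≠] y) (𝓝 (F y / P y)) :=
      ((hF.continuous.tendsto y).div (hP.continuous.tendsto y) hy).mono_left nhdsWithin_le_nhds
    refine hc.congr' ?_
    have hw : ∀ᶠ w in 𝓝[≠] y, w ≠ x₀ := by
      by_cases hyx : y = x₀
      · subst hyx; exact eventually_mem_nhdsWithin
      · exact nhdsWithin_le_nhds (eventually_ne_nhds hyx)
    filter_upwards [hw] with w hw
    rw [hfe, hpe, mul_div_mul_left _ _ (pow_ne_zero _ (sub_ne_zero.2 hw))]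
  exact ⟨(hF.contDiffAt.div hP.contDiffAt h0).congr_of_eventuallyEq key,
    key.self_of_nhds.trans hc⟩

/-- If the zeros of `p` are, with multiplicity, zeros of `f`, then `f` is a smooth multiple
of `p`. -/
theorem exists_eq_mul_of_hasLocalQuotient (f p : SmoothCircle)
    (h : ∀ x ∈ Set.Ico 0 (2 * Real.pi), (p : ℝ → ℝ) x = 0 →
      ∃ c, HasLocalQuotient (f : ℝ → ℝ) (p : ℝ → ℝ) x c) :
    ∃ K : SmoothCircle, f = p * K ∧
      ∀ x c, HasLocalQuotient (f : ℝ → ℝ) (p : ℝ → ℝ) x c → (K : ℝ → ℝ) x = c := by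
  have hall : ∀ x, ∃ c, HasLocalQuotient (f : ℝ → ℝ) (p : ℝ → ℝ) x c := fun x => by
    by_cases hx : (p : ℝ → ℝ) x = 0
    · have hy := toIcoMod_mem_Ico' Real.two_pi_pos x
      have hxy := toIcoMod_add_toIcoDiv_zsmul Real.two_pi_pos 0 x
      set y := toIcoMod Real.two_pi_pos 0 x
      obtain ⟨c, hc⟩ := h y hy (by rw [← hx, ← hxy, (p.2.2.zsmul _)])
      refine ⟨c, ?_⟩
      rw [← hxy]
      exact hc.translate (f.2.2.zsmul _) (p.2.2.zsmul _)
    · exact ⟨_, hasLocalQuotient_of_ne_zero f.2.1 p.2.1 hx⟩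
  refine ⟨⟨extendedQuotient f p, contDiff_iff_contDiffAt.2 fun x => ?_, fun x => ?_⟩, ?_, ?_⟩
  · exact (hall x).choose_spec.exists_contDiffAt.1
  · obtain ⟨c, hc⟩ := hall x
    rw [hc.exists_contDiffAt.2, (hc.translate f.2.2 p.2.2).exists_contDiffAt.2]
  · ext x
    obtain ⟨c, hc⟩ := hall x
    show (f : ℝ → ℝ) x = (p : ℝ → ℝ) x * extendedQuotient f p x
    rw [hc.exists_contDiffAt.2]
    obtain ⟨m, F, P, hF, hP, hfe, hpe, h0, hc⟩ := hc
    rw [← hc, hfe, hpe]; field_simp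
  · exact fun x c hc => hc.exists_contDiffAt.2

/-! ### The trigonometric polynomial with the given zeros -/

/-- Lists the zeros with repetition. The product identity is the only property of the list that is
needed. -/
theorem HasZerosWithMultiplicity.exists_fin {g : ℝ → ℝ} {N : ℕ}
    (h : HasZerosWithMultiplicity g N) : ∃ (s : Finset ℝ) (m : ℝ → ℕ) (θ : Fin N → ℝ),
      (∀ x : ℝ, x ∈ s ↔ x ∈ Set.Ico 0 (2 * Real.pi) ∧ g x = 0) ∧
      (∀ x ∈ s, (∀ j < m x, iteratedDeriv j g x = 0) ∧ iteratedDeriv (m x) g x ≠ 0) ∧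
      ∀ f : ℝ → ℝ, ∏ i, f (θ i) = ∏ x ∈ s, f x ^ m x := by
  obtain ⟨s, m, hs, hm, hN⟩ := h
  have hcard : Fintype.card (Σ x : s, Fin (m x)) = N := by
    rw [Fintype.card_sigma, ← hN, ← Finset.sum_coe_sort s m]; simp
  let e := Fintype.equivFinOfCardEq hcard
  refine ⟨s, m, fun i => (e.symm i).1, hs, hm, fun f => ?_⟩
  rw [Equiv.prod_comp e.symm fun i => f i.1, Fintype.prod_sigma, ← Finset.prod_coe_sort s]
  simp

/-- The trigonometric polynomial `∏ 2 sin ((x - θ_i) / 2)` with an even number of zeros. -/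
noncomputable def sineProduct {n : ℕ} (θ : Fin (2 * n) → ℝ) : SmoothCircle :=
  ⟨fun x => ∏ i, 2 * Real.sin ((x - θ i) / 2), by
    constructor
    · refine contDiff_prod fun i _ => ?_
      fun_prop
    · intro x
      have h : ∀ i, 2 * Real.sin ((x + 2 * Real.pi - θ i) / 2)
          = -1 * (2 * Real.sin ((x - θ i) / 2)) := fun i => by
        rw [show (x + 2 * Real.pi - θ i) / 2 = (x - θ i) / 2 + Real.pi by ring, Real.sin_add_pi]
        ring
      simp only [h, Finset.prod_mul_distrib]
      simp⟩

/-- Each factor carries e^{-ix/2}; over 2n factors this becomes e^{-inx}, and the product is a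
genuine trigonometric polynomial of degree n. -/
theorem two_mul_sin_half (x y : ℝ) : ((2 * Real.sin ((x - y) / 2) : ℝ) : ℂ)
    = -Complex.I * Complex.exp (-(Complex.I * (x + y) / 2))
      * (Complex.exp (Complex.I * x) - Complex.exp (Complex.I * y)) := by
  rw [mul_assoc, mul_sub, ← Complex.exp_add, ← Complex.exp_add]
  push_cast
  rw [Complex.sin, show -(Complex.I * (x + y) / 2) + Complex.I * x
    = ((x : ℂ) - y) / 2 * Complex.I by ring, show -(Complex.I * (x + y) / 2) + Complex.I * y
    = -(((x : ℂ) - y) / 2) * Complex.I by ring]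
  ring

theorem sineProduct_eq {n : ℕ} (θ : Fin (2 * n) → ℝ) (x : ℝ) :
    (((sineProduct θ : ℝ → ℝ) x : ℝ) : ℂ)
      = (-1) ^ n * Complex.exp (-(Complex.I * (∑ i, θ i : ℝ) / 2)) * Complex.exp (-(Complex.I * n * x))
        * ∏ i, (Complex.exp (Complex.I * x) - Complex.exp (Complex.I * θ i)) := by
  show ((∏ i, 2 * Real.sin ((x - θ i) / 2) : ℝ) : ℂ) = _
  rw [Complex.ofReal_prod]
  simp only [two_mul_sin_half, Finset.prod_mul_distrib]
  congr 1
  rw [← Complex.exp_sum, mul_assoc, ← Complex.exp_add]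
  congr 1
  · rw [Finset.prod_const, Finset.card_univ, Fintype.card_fin, pow_mul]; simp
  · congr 1
    rw [Finset.sum_neg_distrib, ← Finset.sum_div, ← Finset.mul_sum, Finset.sum_add_distrib]
    simp only [Finset.sum_const, Finset.card_univ, Fintype.card_fin]
    push_cast
    rw [nsmul_eq_mul]
    push_cast
    ring

theorem sin_half_ne_zero {x y : ℝ} (hx : x ∈ Set.Ico 0 (2 * Real.pi))
    (hy : y ∈ Set.Ico 0 (2 * Real.pi)) (h : x ≠ y) : 2 * Real.sin ((x - y) / 2) ≠ 0 := by
  intro h0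
  have h1 : Real.sin ((x - y) / 2) = 0 := by linarith
  rw [Real.sin_eq_zero_iff_of_lt_of_lt (by linarith [hx.1, hy.2]) (by linarith [hx.2, hy.1])] at h1
  exact h (by linarith)

theorem exists_two_mul_sin_half_eq (y : ℝ) : ∃ S : ℝ → ℝ, ContDiff ℝ ∞ S ∧ S y ≠ 0 ∧
    ∀ x, 2 * Real.sin ((x - y) / 2) = (x - y) * S x := by
  have hd : HasDerivAt (fun x : ℝ => 2 * Real.sin ((x - y) / 2)) 1 y := by
    have h1 : HasDerivAt (fun x : ℝ => (x - y) / 2) (1 / 2) y :=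
      ((hasDerivAt_id y).sub_const y).div_const 2
    convert! (h1.sin).const_mul 2 using 1
    simp
  obtain ⟨S, hS, h, h0⟩ := exists_contDiff_eq_pow_mul 1
    (f := fun x : ℝ => 2 * Real.sin ((x - y) / 2)) (by fun_prop) (φ := y) (by simp)
  refine ⟨S, hS, ?_, by simpa using h⟩
  rw [h0, iteratedDeriv_one, hd.deriv]
  simp

/-- A distribution which almost changes its sign `2n` times becomes nonnegative after
multiplication by a suitable trigonometric polynomial of degree `n` with `2n` real zeros. -/
theorem AlmostChangesSign.exists_trigPolynomial {T : CircleDistribution} {n : ℕ}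
    (hT : AlmostChangesSign T (2 * n)) :
    ∃ (θ : Fin (2 * n) → ℝ) (A : ℂ) (p : SmoothCircle), ‖A‖ = 1 ∧
      A ^ 2 * ∏ i, Complex.exp (Complex.I * θ i) = 1 ∧
      (∀ x : ℝ, (((p : ℝ → ℝ) x : ℝ) : ℂ) = A * Complex.exp (-(Complex.I * n * x))
        * ∏ i, (Complex.exp (Complex.I * x) - Complex.exp (Complex.I * θ i))) ∧
      ∀ f : SmoothCircle, (∀ x : ℝ, 0 ≤ (f : ℝ → ℝ) x) → 0 ≤ T (p * f) := by
  obtain ⟨g, hg, hpos⟩ := hT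
  obtain ⟨s, m, θ, hs, hm, hθ⟩ := hg.exists_fin
  have hq : ∀ x, (sineProduct θ : ℝ → ℝ) x = ∏ y ∈ s, (2 * Real.sin ((x - y) / 2)) ^ m y :=
    fun x => hθ fun y => 2 * Real.sin ((x - y) / 2)
  have hloc : ∀ x ∈ Set.Ico 0 (2 * Real.pi), (g : ℝ → ℝ) x = 0 → ∃ c, c ≠ 0 ∧
      HasLocalQuotient (sineProduct θ : ℝ → ℝ) (g : ℝ → ℝ) x c := by
    intro x hx h0
    have hxs := (hs x).2 ⟨hx, h0⟩
    obtain ⟨G, hG, hGe, hG0⟩ := exists_contDiff_eq_pow_mul (m x) g.2.1 (hm x hxs).1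
    obtain ⟨S, hS, hS0, hSe⟩ := exists_two_mul_sin_half_eq x
    have hGx : G x ≠ 0 := by
      rw [hG0]; exact div_ne_zero (hm x hxs).2 (by exact_mod_cast (m x).factorial_ne_zero)
    have hF : S x ^ m x * ∏ y ∈ s.erase x, (2 * Real.sin ((x - y) / 2)) ^ m y ≠ 0 := by
      refine mul_ne_zero (pow_ne_zero _ hS0) (Finset.prod_ne_zero_iff.2 fun y hy => pow_ne_zero _ ?_)
      rw [Finset.mem_erase] at hy
      exact sin_half_ne_zero hx ((hs y).1 hy.2).1 (Ne.symm hy.1)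
    refine ⟨_, div_ne_zero hF hGx, m x,
      fun w => S w ^ m x * ∏ y ∈ s.erase x, (2 * Real.sin ((w - y) / 2)) ^ m y, G,
      (hS.pow _).mul (contDiff_prod fun y _ => ContDiff.pow (by fun_prop) _), hG, fun w => ?_,
      hGe, hGx, rfl⟩
    rw [hq, ← Finset.mul_prod_erase s _ hxs, hSe, mul_pow, mul_assoc]
  obtain ⟨K, hK, hKval⟩ := exists_eq_mul_of_hasLocalQuotient (sineProduct θ) g
    fun x hx h0 => (hloc x hx h0).imp fun c hc => hc.2
  have hK0 : ∀ x, (K : ℝ → ℝ) x ≠ 0 := by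
    intro x
    have hy := toIcoMod_mem_Ico' Real.two_pi_pos x
    rw [← toIcoMod_add_toIcoDiv_zsmul Real.two_pi_pos 0 x, K.2.2.zsmul]
    set y := toIcoMod Real.two_pi_pos 0 x
    by_cases h0 : (g : ℝ → ℝ) y = 0
    · obtain ⟨c, hc0, hc⟩ := hloc y hy h0
      rwa [hKval y c hc]
    · rw [hKval y _ (hasLocalQuotient_of_ne_zero (sineProduct θ).2.1 g.2.1 h0)]
      refine div_ne_zero ?_ h0
      rw [hq]
      refine Finset.prod_ne_zero_iff.2 fun z hz => pow_ne_zero _ (sin_half_ne_zero hy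
        ((hs z).1 hz).1 ?_)
      rintro rfl
      exact h0 ((hs _).1 hz).2
  -- By the intermediate value theorem the nonvanishing quotient K has constant sign. Here K is
  -- `sineProduct θ` divided by g, so ε K f is again a nonnegative test function for g.
  obtain ⟨ε, hε, hεK⟩ : ∃ ε : ℝ, (ε = 1 ∨ ε = -1) ∧ ∀ x, 0 ≤ ε * (K : ℝ → ℝ) x := by
    by_contra! hcon
    obtain ⟨x, hx⟩ := hcon 1 (Or.inl rfl)
    obtain ⟨y, hy⟩ := hcon (-1) (Or.inr rfl)
    obtain ⟨w, hw⟩ := mem_range_of_exists_le_of_exists_ge K.2.1.continuous (c := 0)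
      ⟨x, by linarith⟩ ⟨y, by linarith⟩
    exact hK0 w hw
  refine ⟨θ, ε * ((-1) ^ n * Complex.exp (-(Complex.I * (∑ i, θ i : ℝ) / 2))),
    ε • sineProduct θ, ?_, ?_, fun x => ?_, fun f hf => ?_⟩
  · have : ‖Complex.exp (-(Complex.I * (∑ i, θ i : ℝ) / 2))‖ = 1 := by
      rw [Complex.norm_exp]; simp
    rcases hε with rfl | rfl <;> simp only [norm_mul, this] <;> simp
  · have h1 : ((ε : ℂ)) ^ 2 = 1 := by rcases hε with rfl | rfl <;> simp
    have h2 : (((-1 : ℂ)) ^ n) ^ 2 = 1 := by rw [← pow_mul, mul_comm, pow_mul]; simp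
    rw [mul_pow, mul_pow, h1, h2, one_mul, one_mul, ← Complex.exp_nat_mul, ← Complex.exp_sum,
      ← Complex.exp_add, ← Finset.mul_sum]
    convert Complex.exp_zero using 2
    push_cast; ring
  · show ((ε * (sineProduct θ : ℝ → ℝ) x : ℝ) : ℂ) = _
    rw [Complex.ofReal_mul, sineProduct_eq]; ring
  · have : ε • sineProduct θ * f = g * (ε • K * f) := by rw [hK]; simp [mul_assoc]
    rw [this]
    exact hpos _ fun x => mul_nonneg (hεK x) (hf x)

/-! ### Complex test functions: exponentials and the Cauchy kernel -/

/-- Complex-valued smooth functions on the unit circle. -/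
def ComplexSmoothCircle : Subalgebra ℂ (ℝ → ℂ) where
  carrier := {f | ContDiff ℝ ∞ f ∧ Function.Periodic f (2 * Real.pi)}
  mul_mem' hf hg := ⟨hf.1.mul hg.1, hf.2.mul hg.2⟩
  add_mem' hf hg := ⟨hf.1.add hg.1, hf.2.add hg.2⟩
  algebraMap_mem' _ := ⟨contDiff_const, fun _ => rfl⟩

namespace ComplexSmoothCircle

/-- The real part of a smooth function on the circle. -/
def re (f : ComplexSmoothCircle) : SmoothCircle :=
  ⟨fun x => ((f : ℝ → ℂ) x).re, Complex.reCLM.contDiff.comp f.2.1,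
    fun x => congrArg Complex.re (f.2.2 x)⟩

/-- The imaginary part of a smooth function on the circle. -/
def im (f : ComplexSmoothCircle) : SmoothCircle :=
  ⟨fun x => ((f : ℝ → ℂ) x).im, Complex.imCLM.contDiff.comp f.2.1,
    fun x => congrArg Complex.im (f.2.2 x)⟩

/-- A real smooth function on the circle seen as a complex-valued one. -/
def ofReal (f : SmoothCircle) : ComplexSmoothCircle :=
  ⟨fun x => ((f : ℝ → ℝ) x : ℂ), Complex.ofRealCLM.contDiff.comp f.2.1,
    fun x => congrArg Complex.ofReal (f.2.2 x)⟩

theorem re_apply (f : ComplexSmoothCircle) (x : ℝ) :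
    (re f : ℝ → ℝ) x = ((f : ℝ → ℂ) x).re := rfl

theorem im_apply (f : ComplexSmoothCircle) (x : ℝ) :
    (im f : ℝ → ℝ) x = ((f : ℝ → ℂ) x).im := rfl

theorem ofReal_apply (f : SmoothCircle) (x : ℝ) :
    (ofReal f : ℝ → ℂ) x = ((f : ℝ → ℝ) x : ℂ) := rfl

theorem mul_apply (f g : ComplexSmoothCircle) (x : ℝ) :
    ((f * g : ComplexSmoothCircle) : ℝ → ℂ) x = (f : ℝ → ℂ) x * (g : ℝ → ℂ) x := rfl

theorem add_apply (f g : ComplexSmoothCircle) (x : ℝ) :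
    ((f + g : ComplexSmoothCircle) : ℝ → ℂ) x = (f : ℝ → ℂ) x + (g : ℝ → ℂ) x := rfl

theorem smul_apply (c : ℂ) (f : ComplexSmoothCircle) (x : ℝ) :
    ((c • f : ComplexSmoothCircle) : ℝ → ℂ) x = c * (f : ℝ → ℂ) x := rfl

theorem one_apply (x : ℝ) : ((1 : ComplexSmoothCircle) : ℝ → ℂ) x = 1 := rfl

theorem sum_apply {ι : Type*} (s : Finset ι) (f : ι → ComplexSmoothCircle) (x : ℝ) :
    ((∑ i ∈ s, f i : ComplexSmoothCircle) : ℝ → ℂ) x = ∑ i ∈ s, (f i : ℝ → ℂ) x := by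
  rw [AddSubmonoidClass.coe_finsetSum, Finset.sum_apply]

/-- The exponential `x ↦ e^{ikx}`. -/
noncomputable def exp (k : ℤ) : ComplexSmoothCircle :=
  ⟨fun x => Complex.exp (Complex.I * k * x),
    Complex.contDiff_exp.comp (contDiff_const.mul Complex.ofRealCLM.contDiff), fun x => by
      rw [Complex.exp_eq_exp_iff_exists_int]
      exact ⟨k, by push_cast; ring⟩⟩

theorem exp_apply (k : ℤ) (x : ℝ) :
    (exp k : ℝ → ℂ) x = Complex.exp (Complex.I * k * x) := rfl

theorem exp_zero : exp 0 = 1 := by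
  ext x; simp [exp_apply]

theorem exp_add (k l : ℤ) : exp (k + l) = exp k * exp l := by
  ext x
  simp only [mul_apply, exp_apply]
  rw [← Complex.exp_add]; push_cast; congr 1; ring

theorem norm_exp_apply (k : ℤ) (x : ℝ) : ‖(exp k : ℝ → ℂ) x‖ = 1 := by
  rw [exp_apply, Complex.norm_exp]; simp

theorem one_sub_mul_exp_ne_zero {z : ℂ} (hz : ‖z‖ < 1) (x : ℝ) :
    1 - z * (exp (-1) : ℝ → ℂ) x ≠ 0 := by
  intro h
  have : ‖z * (exp (-1) : ℝ → ℂ) x‖ = 1 := by rw [← sub_eq_zero.1 h]; simp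
  rw [norm_mul, norm_exp_apply, mul_one] at this
  exact hz.ne this

/-- The Cauchy kernel `x ↦ 1 / (1 - z e^{-ix})`. -/
noncomputable def cauchy (z : ℂ) (hz : ‖z‖ < 1) : ComplexSmoothCircle :=
  ⟨fun x => (1 - z * (exp (-1) : ℝ → ℂ) x)⁻¹,
    (contDiff_const.sub (contDiff_const.mul (exp (-1)).2.1)).inv
      (one_sub_mul_exp_ne_zero hz), fun x => by
      show (1 - z * (exp (-1) : ℝ → ℂ) (x + 2 * Real.pi))⁻¹ = _
      rw [(exp (-1)).2.2 x]⟩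

theorem cauchy_apply (z : ℂ) (hz : ‖z‖ < 1) (x : ℝ) :
    (cauchy z hz : ℝ → ℂ) x = (1 - z * (exp (-1) : ℝ → ℂ) x)⁻¹ := rfl

theorem cauchy_eq (z : ℂ) (hz : ‖z‖ < 1) :
    cauchy z hz = 1 + z • (exp (-1) * cauchy z hz) := by
  ext x
  have := one_sub_mul_exp_ne_zero hz x
  simp only [add_apply, smul_apply, mul_apply, one_apply, cauchy_apply]
  field_simp; ring

/-- The geometric series is kept as a finite sum with an exact remainder, so that `T` can be applied
termwise without any convergence in the space of test functions. -/
theorem exp_mul_cauchy_eq_sum (k : ℤ) (z : ℂ) (hz : ‖z‖ < 1) (M : ℕ) :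
    exp (-k) * cauchy z hz = ∑ m ∈ Finset.range M, z ^ m • exp (-(k + m))
      + z ^ M • (exp (-(k + M)) * cauchy z hz) := by
  induction M with
  | zero => simp
  | succ M ih =>
    rw [ih, Finset.sum_range_succ, add_assoc]
    congr 1
    rw [show -(k + ((M + 1 : ℕ) : ℤ)) = -(k + M) + -1 by push_cast; ring, exp_add]
    conv_lhs => rw [cauchy_eq z hz]
    rw [mul_add, mul_one, smul_add, pow_succ, mul_smul, mul_assoc, mul_smul_comm]

theorem iteratedDeriv_exp (k : ℤ) (j : ℕ) :
    iteratedDeriv j (exp k : ℝ → ℂ) = fun x => (Complex.I * k) ^ j * (exp k : ℝ → ℂ) x := by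
  induction j with
  | zero => simp
  | succ j ih =>
    rw [iteratedDeriv_succ, ih]
    ext x
    have h1 : HasDerivAt (fun x : ℝ => Complex.I * k * (x : ℂ)) (Complex.I * k) x := by
      simpa using (Complex.ofRealCLM.hasDerivAt (x := x)).const_mul (Complex.I * (k : ℂ))
    have h2 := h1.cexp.const_mul ((Complex.I * (k : ℂ)) ^ j)
    rw [show (fun x : ℝ => (Complex.I * (k : ℂ)) ^ j * (exp k : ℝ → ℂ) x) = fun x : ℝ =>
      (Complex.I * (k : ℂ)) ^ j * Complex.exp (Complex.I * k * x) from rfl, h2.deriv, exp_apply]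
    ring

theorem contDiff_iteratedDeriv {E : Type*} [NormedAddCommGroup E] [NormedSpace ℝ E] {f : ℝ → E}
    (hf : ContDiff ℝ ∞ f) (j : ℕ) : ContDiff ℝ ∞ (iteratedDeriv j f) := by
  rw [iteratedDeriv_eq_iterate]; exact hf.iterate_deriv j

theorem iteratedDeriv_clm {L : ℂ →L[ℝ] ℝ} {f : ℝ → ℂ} (hf : ContDiff ℝ ∞ f) (j : ℕ) :
    iteratedDeriv j (fun x => L (f x)) = fun x => L (iteratedDeriv j f x) := by
  induction j with
  | zero => simp
  | succ j ih =>
    rw [iteratedDeriv_succ, ih, iteratedDeriv_succ]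
    ext x
    exact (L.hasFDerivAt.comp_hasDerivAt x
      (((contDiff_iteratedDeriv hf j).differentiable (by simp)) x).hasDerivAt).deriv

theorem exists_bound_iteratedDeriv (f : ComplexSmoothCircle) (N : ℕ) :
    ∃ B, ∀ j ≤ N, ∀ x, ‖iteratedDeriv j (f : ℝ → ℂ) x‖ ≤ B := by
  have h : ∀ j, ∃ B, ∀ x, ‖iteratedDeriv j (f : ℝ → ℂ) x‖ ≤ B := by
    intro j
    obtain ⟨B, hB⟩ := (isCompact_Icc (a := (0 : ℝ)) (b := 2 * Real.pi)).exists_bound_of_continuousOn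
      (contDiff_iteratedDeriv f.2.1 j).continuous.continuousOn
    have hper : Function.Periodic (iteratedDeriv j (f : ℝ → ℂ)) (2 * Real.pi) := fun x => by
      rw [← congrFun (iteratedDeriv_comp_add_const j (f : ℝ → ℂ) (2 * Real.pi)) x]
      congr 1
      exact funext f.2.2
    refine ⟨B, fun x => ?_⟩
    rw [← toIcoMod_add_toIcoDiv_zsmul Real.two_pi_pos 0 x, hper.zsmul]
    exact hB _ (Set.Ico_subset_Icc_self (toIcoMod_mem_Ico' Real.two_pi_pos x))
  choose B hB using h
  refine ⟨∑ j ∈ Finset.range (N + 1), B j, fun j hj x => (hB j x).trans ?_⟩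
  exact Finset.single_le_sum (f := B) (fun i _ => (norm_nonneg _).trans (hB i 0))
    (Finset.mem_range.2 (by omega))

end ComplexSmoothCircle

/-! ### Fourier coefficients and the analytic completion of the Poisson extension -/

open ComplexSmoothCircle

/-- The complex-linear extension of a real linear functional. -/
noncomputable def CircleDistribution.complexify (T : CircleDistribution) :
    ComplexSmoothCircle →ₗ[ℂ] ℂ where
  toFun f := T (re f) + Complex.I * T (im f)
  map_add' f g := by
    have h1 : (re (f + g)) = (re f) + (re g) := by ext x; simp [re_apply]
    have h2 : (im (f + g)) = (im f) + (im g) := by ext x; simp [im_apply]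
    rw [h1, h2, map_add, map_add]; push_cast; ring
  map_smul' c f := by
    have h1 : re (c • f) = c.re • (re f) - c.im • (im f) := by ext x; simp [re_apply, im_apply]
    have h2 : im (c • f) = c.re • (im f) + c.im • (re f) := by ext x; simp [re_apply, im_apply]
    rw [h1, h2, map_sub, map_add, map_smul, map_smul, map_smul, map_smul]
    apply Complex.ext <;> simp

theorem CircleDistribution.complexify_re (T : CircleDistribution) (f : ComplexSmoothCircle) :
    (T.complexify f).re = T (re f) := by
  simp [CircleDistribution.complexify]

theorem CircleDistribution.complexify_im (T : CircleDistribution) (f : ComplexSmoothCircle) :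
    (T.complexify f).im = T (im f) := by
  simp [CircleDistribution.complexify]

theorem CircleDistribution.exists_norm_complexify_le (T : CircleDistribution) :
    ∃ (N : ℕ) (C : ℝ), 0 ≤ C ∧ ∀ (f : ComplexSmoothCircle) (M : ℝ),
      (∀ j ≤ N, ∀ x, ‖iteratedDeriv j (f : ℝ → ℂ) x‖ ≤ M) → ‖T.complexify f‖ ≤ C * M := by
  obtain ⟨N, C, h⟩ := T.bounded'
  refine ⟨N, 2 * |C|, by positivity, fun f M hM => ?_⟩
  have h1 := h (re f) M fun j hj x => by
    have := congrFun (iteratedDeriv_clm (L := Complex.reCLM) f.2.1 j) x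
    rw [show (re f : ℝ → ℝ) = fun x => Complex.reCLM ((f : ℝ → ℂ) x) from rfl, this]
    exact (Complex.abs_re_le_norm _).trans (hM j hj x)
  have h2 := h (im f) M fun j hj x => by
    have := congrFun (iteratedDeriv_clm (L := Complex.imCLM) f.2.1 j) x
    rw [show (im f : ℝ → ℝ) = fun x => Complex.imCLM ((f : ℝ → ℂ) x) from rfl, this]
    exact (Complex.abs_im_le_norm _).trans (hM j hj x)
  have hM0 : 0 ≤ M := (norm_nonneg _).trans (hM 0 (Nat.zero_le _) 0)
  have hCM : C * M ≤ |C| * M := mul_le_mul_of_nonneg_right (le_abs_self C) hM0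
  have h3 := Complex.norm_le_abs_re_add_abs_im (T.complexify f)
  rw [T.complexify_re, T.complexify_im] at h3
  linarith

/-- The Fourier coefficient `T(e^{-ikx})`. -/
noncomputable def CircleDistribution.fourier (T : CircleDistribution) (k : ℤ) : ℂ :=
  T.complexify (exp (-k))

theorem CircleDistribution.fourier_neg (T : CircleDistribution) (k : ℤ) :
    T.fourier (-k) = (starRingEnd ℂ) (T.fourier k) := by
  have h1 : (re (exp (-(-k)))) = (re (exp (-k))) := by
    ext x; simp [re_apply, exp_apply, Complex.exp_re]
  have h2 : (im (exp (-(-k)))) = -(im (exp (-k))) := by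
    ext x; simp [im_apply, exp_apply, Complex.exp_im]
  apply Complex.ext
  · rw [Complex.conj_re, fourier, fourier, complexify_re, complexify_re, h1]
  · rw [Complex.conj_im, fourier, fourier, complexify_im, complexify_im, h2, map_neg]

/-- The seminorm bound of order N and the Leibniz rule: each derivative of e^{ikx} costs one factor
|k|. -/
theorem CircleDistribution.exists_polynomial_growth (T : CircleDistribution)
    (g : ComplexSmoothCircle) : ∃ (N : ℕ) (C : ℝ), ∀ k : ℤ,
      ‖T.complexify (exp k * g)‖ ≤ C * (|(k : ℝ)| + 1) ^ N := by
  obtain ⟨N, C, hC, h⟩ := T.exists_norm_complexify_le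
  obtain ⟨B, hB⟩ := exists_bound_iteratedDeriv g N
  have hB0 : 0 ≤ B := (norm_nonneg _).trans (hB 0 (Nat.zero_le _) 0)
  refine ⟨N, C * (2 ^ N * B), fun k => ?_⟩
  rw [mul_assoc]
  refine h _ _ fun j hj x => ?_
  have h1 : (1 : ℝ) ≤ |(k : ℝ)| + 1 := by linarith [abs_nonneg (k : ℝ)]
  rw [show ((exp k * g : ComplexSmoothCircle) : ℝ → ℂ) = (exp k : ℝ → ℂ) * (g : ℝ → ℂ) from rfl,
    iteratedDeriv_mul (((exp k).2.1.of_le (by exact_mod_cast le_top)).contDiffAt)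
      ((g.2.1.of_le (by exact_mod_cast le_top)).contDiffAt)]
  calc _ ≤ ∑ i ∈ Finset.range (j + 1), (j.choose i : ℝ) * (B * (|(k : ℝ)| + 1) ^ N) := by
        refine (norm_sum_le _ _).trans (Finset.sum_le_sum fun i hi => ?_)
        rw [mul_assoc, norm_mul, norm_mul, iteratedDeriv_exp]
        simp only [norm_mul, norm_exp_apply, norm_pow, Complex.norm_I, Complex.norm_intCast,
          one_mul, mul_one, Complex.norm_natCast]
        rw [mul_comm B]
        gcongr
        · calc |(k : ℝ)| ^ i ≤ (|(k : ℝ)| + 1) ^ i := by gcongr; linarith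
            _ ≤ _ := pow_le_pow_right₀ h1 (by rw [Finset.mem_range] at hi; omega)
        · exact hB _ (by omega) x
    _ = 2 ^ j * (B * (|(k : ℝ)| + 1) ^ N) := by
        rw [← Finset.sum_mul]; congr 1; exact_mod_cast Nat.sum_range_choose j
    _ ≤ _ := by
        rw [← mul_assoc]
        have : (2 : ℝ) ^ j ≤ 2 ^ N := pow_le_pow_right₀ (by norm_num) hj
        gcongr

theorem summable_add_pow_mul_geometric {a r : ℝ} (ha : 0 ≤ a) (hr0 : 0 < r) (hr1 : r < 1) (N : ℕ) :
    Summable fun m : ℕ => (a + m + 1) ^ N * r ^ m := by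
  have h := (summable_nat_add_iff 1).2 (summable_pow_mul_geometric_of_norm_lt_one N (r := r)
    (by rwa [Real.norm_eq_abs, abs_of_pos hr0]))
  refine Summable.of_nonneg_of_le (fun m => by positivity) (fun m => ?_)
    (h.mul_left ((a + 1) ^ N * r⁻¹))
  rw [pow_succ]
  have : (a + m + 1) ^ N ≤ (a + 1) ^ N * (((m + 1 : ℕ) : ℝ)) ^ N := by
    rw [← mul_pow]
    gcongr
    push_cast
    nlinarith [mul_nonneg ha (Nat.cast_nonneg (α := ℝ) m)]
  calc (a + m + 1) ^ N * r ^ m ≤ ((a + 1) ^ N * (((m + 1 : ℕ) : ℝ)) ^ N) * r ^ m := by gcongr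
    _ = _ := by field_simp

/-- Polynomial growth loses against r^m. The case g = 1 controls the terms of the power series, the
case of the Cauchy kernel its remainder. -/
theorem CircleDistribution.exists_summable_bound (T : CircleDistribution)
    (g : ComplexSmoothCircle) (k : ℤ) {r : ℝ} (hr0 : 0 < r) (hr1 : r < 1) :
    ∃ b : ℕ → ℝ, Summable b ∧ ∀ (m : ℕ) (z : ℂ), ‖z‖ ≤ r →
      ‖z ^ m * T.complexify (exp (-(k + m)) * g)‖ ≤ b m := by
  obtain ⟨N, C, hC⟩ := T.exists_polynomial_growth g
  have hC0 : 0 ≤ C := by simpa using (norm_nonneg _).trans (hC 0)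
  refine ⟨fun m => C * ((|(k : ℝ)| + m + 1) ^ N * r ^ m),
    (summable_add_pow_mul_geometric (abs_nonneg _) hr0 hr1 N).mul_left C, fun m z hz => ?_⟩
  show _ ≤ C * ((|(k : ℝ)| + m + 1) ^ N * r ^ m)
  rw [norm_mul, norm_pow, mul_comm, ← mul_assoc]
  gcongr
  refine (hC _).trans ?_
  gcongr
  push_cast
  rw [abs_neg]
  exact (abs_add_le _ _).trans (by simp)

theorem CircleDistribution.hasSum_fourier (T : CircleDistribution) (k : ℤ) {z : ℂ} (hz : ‖z‖ < 1) :
    HasSum (fun m : ℕ => T.fourier (k + m) * z ^ m) (T.complexify (exp (-k) * cauchy z hz)) := by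
  obtain ⟨r, hr, hr1⟩ := exists_between hz
  have hr0 : 0 < r := (norm_nonneg z).trans_lt hr
  obtain ⟨b, hb, hbz⟩ := T.exists_summable_bound 1 k hr0 hr1
  obtain ⟨b', hb', hbz'⟩ := T.exists_summable_bound (cauchy z hz) k hr0 hr1
  have hs : Summable fun m : ℕ => T.fourier (k + m) * z ^ m :=
    Summable.of_norm_bounded hb fun m => by
      rw [mul_comm]; simpa [fourier] using hbz m z hr.le
  rw [hs.hasSum_iff_tendsto_nat]
  have h0 : Tendsto (fun M : ℕ => z ^ M * T.complexify (exp (-(k + M)) * cauchy z hz)) atTop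
      (𝓝 0) := squeeze_zero_norm (fun M => hbz' M z hr.le) hb'.tendsto_atTop_zero
  have h1 := (tendsto_const_nhds (x := T.complexify (exp (-k) * cauchy z hz))).sub h0
  rw [sub_zero] at h1
  refine h1.congr fun M => ?_
  rw [exp_mul_cauchy_eq_sum k z hz M, map_add, map_sum, map_smul, smul_eq_mul, add_sub_cancel_right]
  exact Finset.sum_congr rfl fun m _ => by rw [map_smul, smul_eq_mul, mul_comm]; rfl

/-- The power series `∑ T(e^{-i(k+m)x}) z^m / π`. -/
noncomputable def CircleDistribution.tail (T : CircleDistribution) (k : ℤ) (z : ℂ) : ℂ :=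
  ∑' m : ℕ, T.fourier (k + m) / Real.pi * z ^ m

theorem CircleDistribution.hasSum_tail (T : CircleDistribution) (k : ℤ) {z : ℂ} (hz : ‖z‖ < 1) :
    HasSum (fun m : ℕ => T.fourier (k + m) / Real.pi * z ^ m)
      (T.complexify (exp (-k) * cauchy z hz) / Real.pi) := by
  convert! (T.hasSum_fourier k hz).div_const (Real.pi : ℂ) using 2
  ring

theorem CircleDistribution.tail_eq (T : CircleDistribution) (k : ℤ) {z : ℂ} (hz : ‖z‖ < 1) :
    T.tail k z = T.complexify (exp (-k) * cauchy z hz) / Real.pi :=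
  (T.hasSum_tail k hz).tsum_eq

theorem CircleDistribution.tail_eq_add (T : CircleDistribution) (k : ℤ) {z : ℂ} (hz : ‖z‖ < 1) :
    T.tail k z = T.fourier k / Real.pi + z * T.tail (k + 1) z := by
  rw [T.tail_eq k hz, T.tail_eq (k + 1) hz, cauchy_eq, mul_add, mul_one, map_add, mul_smul_comm,
    map_smul, ← mul_assoc, ← exp_add, ← cauchy_eq, neg_add, fourier, smul_eq_mul]
  ring

theorem CircleDistribution.tail_zero_eq (T : CircleDistribution) (n : ℕ)
    (h : ∀ k < n, T.fourier k = 0) {z : ℂ} (hz : ‖z‖ < 1) :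
    T.tail 0 z = z ^ n * T.tail n z := by
  induction n with
  | zero => simp
  | succ n ih =>
    rw [ih fun k hk => h k (by omega), T.tail_eq_add n hz, h n (by omega)]
    push_cast; ring

theorem CircleDistribution.analyticAt_tail (T : CircleDistribution) (k : ℤ) :
    AnalyticAt ℂ (T.tail k) 0 := by
  obtain ⟨b, hb, hbz⟩ := T.exists_summable_bound 1 k (r := 1 / 2) (by norm_num) (by norm_num)
  have hd : DifferentiableOn ℂ (fun z => ∑' m : ℕ, T.fourier (k + m) / Real.pi * z ^ m)
      (Metric.ball 0 (1 / 2)) := by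
    refine Complex.differentiableOn_tsum_of_summable_norm (hb.mul_left (1 / Real.pi))
      (fun m => by fun_prop) Metric.isOpen_ball fun m z hz => ?_
    have := hbz m z (by simpa using (mem_ball_zero_iff.1 hz).le)
    rw [mul_one] at this
    rw [div_mul_eq_mul_div, norm_div, Complex.norm_real, Real.norm_of_nonneg Real.pi_pos.le,
      mul_comm, div_eq_inv_mul, one_div]
    gcongr
    exact this
  exact hd.analyticAt (Metric.ball_mem_nhds _ (by norm_num))

theorem CircleDistribution.tail_apply_zero (T : CircleDistribution) (k : ℤ) :
    T.tail k 0 = T.fourier k / Real.pi := by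
  rw [T.tail_eq_add k (by simp)]; simp

theorem CircleDistribution.hasDerivAt_tail (T : CircleDistribution) (k : ℤ) :
    HasDerivAt (T.tail k) (T.fourier (k + 1) / Real.pi) 0 := by
  have h1 : HasDerivAt (fun z => T.fourier k / Real.pi + z * T.tail (k + 1) z)
      (T.fourier (k + 1) / Real.pi) 0 := by
    have h := ((hasDerivAt_id (0 : ℂ)).mul
      (T.analyticAt_tail (k + 1)).differentiableAt.hasDerivAt).const_add (T.fourier k / Real.pi)
    convert! h using 1
    simp [T.tail_apply_zero]
  refine h1.congr_of_eventuallyEq ?_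
  filter_upwards [Metric.ball_mem_nhds (0 : ℂ) one_pos] with z hz
  exact T.tail_eq_add k (mem_ball_zero_iff.1 hz)

/-- With z = |z| e^{iω}, the Poisson kernel is (1/π) Re(1/(1 - z e^{-ix})) - 1/(2π). This makes the
Poisson extension the real part of a power series. -/
theorem poissonTest_eq (z : ℂ) (hz : ‖z‖ < 1) :
    poissonTest z hz = (1 / Real.pi) • re (cauchy z hz) - (1 / (2 * Real.pi)) • (1 : SmoothCircle) := by
  ext x
  show diskPoissonKernel ‖z‖ (z.arg - x)
    = 1 / Real.pi * ((1 - z * (exp (-1) : ℝ → ℂ) x)⁻¹).re - 1 / (2 * Real.pi) * 1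
  have hre : (z * (exp (-1) : ℝ → ℂ) x).re = ‖z‖ * Real.cos (z.arg - x) := by
    rw [exp_apply]
    conv_lhs => rw [← Complex.norm_mul_exp_arg_mul_I z, mul_assoc, ← Complex.exp_add]
    rw [Complex.re_ofReal_mul, show (z.arg : ℂ) * Complex.I + Complex.I * ((-1 : ℤ) : ℂ) * x
      = ((z.arg - x : ℝ) : ℂ) * Complex.I by push_cast; ring, Complex.exp_ofReal_mul_I_re]
  have hn : ‖z * (exp (-1) : ℝ → ℂ) x‖ = ‖z‖ := by rw [norm_mul, norm_exp_apply, mul_one]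
  have hpos := diskPoissonKernel_denom_pos (norm_nonneg z) hz (z.arg - x)
  have hsq : Complex.normSq (1 - z * (exp (-1) : ℝ → ℂ) x)
      = 1 - 2 * ‖z‖ * Real.cos (z.arg - x) + ‖z‖ ^ 2 := by
    rw [Complex.normSq_sub, Complex.normSq_one, Complex.normSq_eq_norm_sq (z * _), hn, one_mul,
      Complex.conj_re, hre]
    ring
  rw [Complex.inv_re, hsq, Complex.sub_re, Complex.one_re, hre, diskPoissonKernel]
  have := Real.pi_ne_zero
  field_simp
  ring

theorem poissonExtension_eq (T : CircleDistribution) {z : ℂ} (hz : ‖z‖ < 1) :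
    poissonExtension T z = (T.tail 0 z).re - T 1 / (2 * Real.pi) := by
  rw [poissonExtension, dif_pos hz, T.tail_eq 0 hz, neg_zero, exp_zero, one_mul,
    Complex.div_ofReal_re, T.complexify_re, poissonTest_eq, map_sub, map_smul, map_smul]
  simp only [smul_eq_mul]
  ring

theorem CircleDistribution.fourier_zero (T : CircleDistribution) : T.fourier 0 = T 1 := by
  have h1 : re 1 = 1 := by ext x; simp [re_apply]
  have h2 : im 1 = 0 := by ext x; simp [im_apply]
  apply Complex.ext
  · rw [fourier, neg_zero, exp_zero, complexify_re, h1, Complex.ofReal_re]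
  · rw [fourier, neg_zero, exp_zero, complexify_im, h2, Complex.ofReal_im, map_zero]

/-! ### Nodal sets near a zero of finite order -/

/-- Finitely many slopes are excluded among the directions (1, s); a vertical vector is never
parallel to such a direction. -/
theorem exists_not_collinear {n : ℕ} (v : Fin n → ℂ) (hv : ∀ i, v i ≠ 0) :
    ∃ d : ℂ, d ≠ 0 ∧ ∀ i, ((starRingEnd ℂ) d * v i).im ≠ 0 := by
  obtain ⟨s, hs⟩ := (Set.finite_range fun i => (v i).im / (v i).re).exists_notMem
  refine ⟨⟨1, s⟩, fun h => by simpa using congrArg Complex.re h, fun i h => ?_⟩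
  simp only [Complex.mul_im, Complex.conj_re, Complex.conj_im] at h
  by_cases hre : (v i).re = 0
  · exact hv i (Complex.ext hre (by rw [hre] at h; simpa using h))
  · exact hs ⟨i, by field_simp; linarith⟩

/-- The nodal set at a point where `n` nodal curves intersect is not a neighbourhood of it. -/
theorem NodalCurvesIntersectAt.not_eventually_eq_zero {u : ℂ → ℝ} {n : ℕ}
    (h : NodalCurvesIntersectAt u 0 n) : ¬ ∀ᶠ z in 𝓝 (0 : ℂ), u z = 0 := by
  intro hu
  obtain ⟨γ, harc, -, hcov⟩ := h
  -- The line along d is transversal to all the arcs, hence meets them near 0 only at 0. If u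
  -- vanished near 0, the arcs would have to cover this line.
  obtain ⟨d, hd, hdv⟩ := exists_not_collinear (fun i => deriv (γ i) 0) fun i => (harc i).2.2.1
  have hN : ∀ᶠ t in 𝓝 (0 : ℝ), ∀ i, ((starRingEnd ℂ) d * γ i t).im = 0 → t = 0 := by
    refine eventually_all.2 fun i => ?_
    have h1 : HasDerivAt (fun t => ((starRingEnd ℂ) d * γ i t).im)
        ((starRingEnd ℂ) d * deriv (γ i) 0).im 0 :=
      Complex.imCLM.hasFDerivAt.comp_hasDerivAt 0
        ((harc i).2.1.differentiableAt.hasDerivAt.const_mul ((starRingEnd ℂ) d))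
    have h2 := h1.eventually_ne (c := 0) (hdv i)
    rw [eventually_nhdsWithin_iff] at h2
    filter_upwards [h2] with t ht h0
    by_contra hne
    exact ht hne h0
  have hline : Tendsto (fun s : ℝ => (s : ℂ) * d) (𝓝[≠] 0) (𝓝 0) := by
    have : Continuous fun s : ℝ => (s : ℂ) * d := by fun_prop
    simpa using (this.tendsto 0).mono_left nhdsWithin_le_nhds
  have hev := hline.eventually ((hcov _ hN).and hu)
  obtain ⟨s, hs, hs0⟩ := (hev.and self_mem_nhdsWithin).exists
  obtain ⟨i, t, ht, hγ⟩ := hs.1 hs.2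
  have ht0 : t = 0 := ht i (by
    rw [hγ, mul_left_comm, Complex.conj_mul', Complex.im_ofReal_mul]; norm_cast; simp)
  rw [ht0, (harc i).1] at hγ
  rcases mul_eq_zero.1 hγ.symm with h | h
  · exact hs0 (by simpa using h)
  · exact hd h

/-- A holomorphic function with a zero of order `m` is the `m`-th power of a local coordinate. -/
theorem exists_local_root {H : ℂ → ℂ} (hH : AnalyticAt ℂ H 0) (h0 : H 0 ≠ 0) {m : ℕ} (hm : 1 ≤ m) :
    ∃ φ : ℂ → ℂ, AnalyticAt ℂ φ 0 ∧ φ 0 = 0 ∧ deriv φ 0 ≠ 0 ∧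
      ∀ᶠ z in 𝓝 (0 : ℂ), φ z ^ m = z ^ m * H z := by
  have hm0 : (m : ℂ) ≠ 0 := by exact_mod_cast (by omega : m ≠ 0)
  obtain ⟨ρ, hρ⟩ := IsAlgClosed.exists_pow_nat_eq (H 0) (by omega : 0 < m)
  have hρ0 : ρ ≠ 0 := by rintro rfl; exact h0 (by rw [← hρ, zero_pow (by omega)])
  -- Division by H(0) brings the argument of the logarithm close to 1, inside the slit plane; ρ
  -- restores the factor H(0).
  have hroot : AnalyticAt ℂ (fun z => ρ * Complex.exp (Complex.log (H z / H 0) / m)) 0 := by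
    refine analyticAt_const.mul ((AnalyticAt.clog (hH.div_const) ?_).div_const).cexp
    rw [div_self h0]; exact Complex.one_mem_slitPlane
  have hd : HasDerivAt (fun z => z * (ρ * Complex.exp (Complex.log (H z / H 0) / m))) ρ 0 := by
    convert! (hasDerivAt_id (0 : ℂ)).mul hroot.differentiableAt.hasDerivAt using 1
    simp [div_self h0]
  refine ⟨fun z => z * (ρ * Complex.exp (Complex.log (H z / H 0) / m)), analyticAt_id.mul hroot,
    by simp, by rwa [hd.deriv], ?_⟩
  filter_upwards [hH.continuousAt.eventually_ne h0] with z hz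
  rw [mul_pow, mul_pow, hρ, ← Complex.exp_nat_mul, mul_div_cancel₀ _ hm0,
    Complex.exp_log (div_ne_zero hz h0), mul_div_cancel₀ _ h0]

theorem tendsto_div_of_hasDerivAt {f : ℝ → ℂ} {e : ℂ} (hf : HasDerivAt f e 0) (h0 : f 0 = 0) :
    Tendsto (fun t : ℝ => f t / t) (𝓝[≠] 0) (𝓝 e) := by
  refine (hasDerivAt_iff_tendsto_slope.1 hf).congr fun t => ?_
  rw [slope_def_module, h0, sub_zero, sub_zero, Complex.real_smul]
  push_cast
  rw [div_eq_inv_mul]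

/-- The tangent of a curve on which `Re z^m` vanishes. -/
theorem re_pow_deriv_eq_zero {f : ℝ → ℂ} {e : ℂ} (hf : HasDerivAt f e 0) (h0 : f 0 = 0) {m : ℕ}
    (h : ∀ᶠ t in 𝓝 (0 : ℝ), (f t ^ m).re = 0) : (e ^ m).re = 0 := by
  have h1 : Tendsto (fun t : ℝ => ((f t / t) ^ m).re) (𝓝[≠] 0) (𝓝 (e ^ m).re) :=
    (Complex.continuous_re.tendsto _).comp ((tendsto_div_of_hasDerivAt hf h0).pow m)
  refine tendsto_nhds_unique h1 (tendsto_const_nhds.congr' ?_)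
  filter_upwards [nhdsWithin_le_nhds h] with t ht
  rw [div_pow, ← Complex.ofReal_pow, Complex.div_ofReal_re, ht, zero_div]

/-- A curve on which `Re z^m` vanishes is contained in its tangent. -/
theorem eventually_im_div_eq_zero {f : ℝ → ℂ} {e : ℂ} (hf : HasDerivAt f e 0) (h0 : f 0 = 0)
    (he : e ≠ 0) {m : ℕ} (hm : 1 ≤ m) (h : ∀ᶠ t in 𝓝 (0 : ℝ), (f t ^ m).re = 0) :
    ∀ᶠ t in 𝓝 (0 : ℝ), (f t / e).im = 0 := by
  have hem := re_pow_deriv_eq_zero hf h0 h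
  have hq : Tendsto (fun t : ℝ => f t / t / e) (𝓝[≠] 0) (𝓝 1) := by
    simpa [he] using (tendsto_div_of_hasDerivAt hf h0).div_const e
  -- The quotient f(t)/(te) tends to 1, where the m-th power is injective. Its m-th power is real,
  -- so it and its conjugate have the same power and must agree.
  have hstrict : HasStrictDerivAt (fun z : ℂ => z ^ m) (m : ℂ) 1 := by
    simpa using hasStrictDerivAt_pow m (1 : ℂ)
  have hm0 : (m : ℂ) ≠ 0 := by exact_mod_cast (by omega : m ≠ 0)
  have hinv := hstrict.eventually_left_inverse hm0
  have hconj : Tendsto (fun t : ℝ => (starRingEnd ℂ) (f t / t / e)) (𝓝[≠] 0) (𝓝 1) := by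
    have := (Complex.continuous_conj.tendsto 1).comp hq
    rwa [map_one] at this
  have hev := (hq.eventually hinv).and ((hconj.eventually hinv).and (nhdsWithin_le_nhds h))
  rw [eventually_nhdsWithin_iff] at hev
  filter_upwards [hev] with t ht
  by_cases ht0 : t = 0
  · rw [ht0, h0]; simp
  · obtain ⟨h1, h2, h3⟩ := ht ht0
    have him : ((f t / t / e) ^ m).im = 0 := by
      have hz : (f t / t / e) ^ m = (f t ^ m / e ^ m) / ((t ^ m : ℝ) : ℂ) := by
        push_cast; rw [div_pow, div_pow, div_right_comm]
      rw [hz, Complex.div_ofReal_im, Complex.div_im, h3, hem]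
      simp
    have hpow : (starRingEnd ℂ) (f t / t / e) ^ m = (f t / t / e) ^ m := by
      rw [← map_pow, Complex.conj_eq_iff_im]; exact him
    have heq : (starRingEnd ℂ) (f t / t / e) = f t / t / e := 
      h2.symm.trans ((congrArg _ hpow).trans h1)
    have him2 := Complex.conj_eq_iff_im.1 heq
    rw [div_right_comm, Complex.div_ofReal_im, div_eq_zero_iff] at him2
    exact him2.resolve_right ht0

/-- Two curves on which `Re z^m` vanishes and which have the same tangent line at `0` have common
points other than `0`. -/
theorem exists_common_point {f g : ℝ → ℂ} {e : ℂ} {c : ℝ} (hf : HasStrictDerivAt f e 0)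
    (hg : HasStrictDerivAt g (c * e) 0) (hf0 : f 0 = 0) (hg0 : g 0 = 0) (he : e ≠ 0) (hc : c ≠ 0)
    {m : ℕ} (hm : 1 ≤ m) (hfm : ∀ᶠ t in 𝓝 (0 : ℝ), (f t ^ m).re = 0)
    (hgm : ∀ᶠ t in 𝓝 (0 : ℝ), (g t ^ m).re = 0) {N : Set ℝ} (hN : N ∈ 𝓝 (0 : ℝ)) :
    ∃ t ∈ N, ∃ s ∈ N, f t = g s ∧ f t ≠ 0 := by
  have hce : (c : ℂ) * e ≠ 0 := mul_ne_zero (by exact_mod_cast hc) he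
  -- The coordinate of the curve along its tangent has derivative 1, so it covers a neighbourhood of
  -- 0. The curve thus fills a whole piece of its tangent line, and two such curves on one line
  -- overlap.
  have key : ∀ {f : ℝ → ℂ} {e : ℂ}, HasStrictDerivAt f e 0 → f 0 = 0 → e ≠ 0 →
      (∀ᶠ t in 𝓝 (0 : ℝ), (f t ^ m).re = 0) → ∀ᶠ x : ℝ in 𝓝 (0 : ℝ), ∃ t ∈ N, f t = x * e := by
    intro f e hf h0 he hfm
    have hr : HasStrictDerivAt (fun t => (f t / e).re) 1 0 := by
      have h1 : HasStrictDerivAt (fun t => f t / e) (1 : ℂ) 0 := by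
        have := hf.mul_const e⁻¹
        rw [mul_inv_cancel₀ he] at this
        simpa only [div_eq_mul_inv] using this
      exact Complex.reCLM.hasStrictFDerivAt.comp_hasStrictDerivAt 0 h1
    have hmap := hr.map_nhds_eq one_ne_zero
    simp only [h0, zero_div, Complex.zero_re] at hmap
    rw [← hmap, eventually_map]
    have : ∀ᶠ t in 𝓝 (0 : ℝ), t ∈ N := hN
    filter_upwards [this, eventually_im_div_eq_zero hf.hasDerivAt h0 he hm hfm] with t ht him
    refine ⟨t, ht, ?_⟩
    rw [show (((f t / e).re : ℝ) : ℂ) = f t / e from Complex.ext rfl (by simp [him]),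
      div_mul_cancel₀ _ he]
  have h1 := key hf hf0 he hfm
  have h2 : ∀ᶠ x : ℝ in 𝓝 (0 : ℝ), ∃ s ∈ N, g s = ((x / c : ℝ) : ℂ) * (c * e) := by
    have ht : Tendsto (fun x : ℝ => x / c) (𝓝 0) (𝓝 0) := by
      simpa using (continuous_id.div_const c).tendsto (0 : ℝ)
    exact ht.eventually (key hg hg0 hce hgm)
  obtain ⟨x, ⟨⟨t, ht, hft⟩, ⟨s, hs, hgs⟩⟩, hx⟩ :=
    (((h1.and h2).filter_mono (nhdsWithin_le_nhds (s := {0}ᶜ))).and self_mem_nhdsWithin).exists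
  have hcc : (c : ℂ) ≠ 0 := by exact_mod_cast hc
  refine ⟨t, ht, s, hs, ?_, ?_⟩
  · rw [hft, hgs]; push_cast; field_simp
  · rw [hft]; exact mul_ne_zero (by exact_mod_cast hx) he

/-- The square of the normalized tangent identifies a line regardless of orientation. These labels
are m-th roots of -1, so at most m lines can occur. -/
theorem sq_normalized_pow_eq_neg_one {e : ℂ} (he : e ≠ 0) {m : ℕ} (h : (e ^ m).re = 0) :
    ((e / ‖e‖) ^ 2) ^ m = -1 := by
  have hn : (‖e‖ : ℂ) ≠ 0 := by exact_mod_cast (norm_ne_zero_iff.2 he)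
  have h1 : e ^ m = (e ^ m).im * Complex.I := Complex.ext (by simp [h]) (by simp)
  have h2 : (e ^ m).im ^ 2 = (‖e‖ ^ m) ^ 2 := by
    rw [← norm_pow, Complex.sq_norm, Complex.normSq_apply, h]; ring
  have h3 : (((e ^ m).im : ℂ)) ^ 2 = ((‖e‖ : ℂ) ^ m) ^ 2 := by exact_mod_cast h2
  rw [div_pow, div_pow, ← pow_mul, ← pow_mul, mul_comm 2 m, pow_mul, pow_mul, h1, mul_pow, h3,
    Complex.I_sq]
  field_simp

theorem exists_real_mul_eq_of_sq_normalized_eq {e e' : ℂ} (he : e ≠ 0) (he' : e' ≠ 0)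
    (h : (e / ‖e‖) ^ 2 = (e' / ‖e'‖) ^ 2) : ∃ c : ℝ, c ≠ 0 ∧ e' = c * e := by
  have hn : ‖e‖ ≠ 0 := norm_ne_zero_iff.2 he
  have hn' : ‖e'‖ ≠ 0 := norm_ne_zero_iff.2 he'
  have hc : (‖e‖ : ℂ) ≠ 0 := by exact_mod_cast hn
  have hc' : (‖e'‖ : ℂ) ≠ 0 := by exact_mod_cast hn'
  rcases sq_eq_sq_iff_eq_or_eq_neg.1 h with h | h
  · refine ⟨‖e'‖ / ‖e‖, div_ne_zero hn' hn, ?_⟩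
    push_cast
    field_simp at h ⊢
    rw [h]
  · refine ⟨-(‖e'‖ / ‖e‖), neg_ne_zero.2 (div_ne_zero hn' hn), ?_⟩
    push_cast
    field_simp at h ⊢
    rw [h]; ring

/-- If `n` nodal curves of `Re w` meet at `0`, then a zero `0` of `w` has order at least `n`. -/
theorem NodalCurvesIntersectAt.le_order {u : ℂ → ℝ} {n m : ℕ} (h : NodalCurvesIntersectAt u 0 n)
    {H : ℂ → ℂ} (hH : AnalyticAt ℂ H 0) (h0 : H 0 ≠ 0) (hm : 1 ≤ m)
    (hu : ∀ᶠ z in 𝓝 (0 : ℂ), u z = (z ^ m * H z).re) : n ≤ m := by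
  obtain ⟨φ, hφ, hφ0, hφd, hφm⟩ := exists_local_root hH h0 hm
  obtain ⟨γ, harc, hdisj, -⟩ := h
  have hγ0 : ∀ i, Tendsto (γ i) (𝓝 0) (𝓝 0) := fun i => by
    have := (harc i).2.1.continuousAt.tendsto
    rwa [(harc i).1] at this
  have hstrict : ∀ i, HasStrictDerivAt (fun t => φ (γ i t)) (deriv φ 0 * deriv (γ i) 0) 0 := by
    intro i
    have h1 := hφ.hasStrictDerivAt
    rw [← (harc i).1] at h1
    have h2 := h1.scomp (0 : ℝ) (harc i).2.1.hasStrictDerivAt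
    rw [(harc i).1, smul_eq_mul, mul_comm] at h2
    exact h2
  have hzero : ∀ i, φ (γ i 0) = 0 := fun i => by rw [(harc i).1, hφ0]
  have hne : ∀ i, deriv φ 0 * deriv (γ i) 0 ≠ 0 := fun i => mul_ne_zero hφd (harc i).2.2.1
  have hre : ∀ i, ∀ᶠ t in 𝓝 (0 : ℝ), (φ (γ i t) ^ m).re = 0 := fun i => by
    filter_upwards [(harc i).2.2.2, (hγ0 i).eventually (hu.and hφm)] with t h1 h2
    rw [h2.2, ← h2.1, h1]
  let ε : Fin n → ℂ := fun i =>
    (deriv φ 0 * deriv (γ i) 0 / ‖deriv φ 0 * deriv (γ i) 0‖) ^ 2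
  have hinj : Function.Injective ε := by
    intro i j hij
    by_contra hne'
    obtain ⟨c, hc, hcj⟩ := exists_real_mul_eq_of_sq_normalized_eq (hne i) (hne j) hij
    obtain ⟨N, hN, hNd⟩ := hdisj i j hne'
    -- Local injectivity of φ pulls a common point of the straightened curves back to a common point
    -- of the original arcs, against their disjointness away from 0.
    have hleft := hφ.hasStrictDerivAt.eventually_left_inverse hφd
    have hN' : ∀ᶠ t in 𝓝 (0 : ℝ), t ∈ N := hN
    have hs := hstrict j
    rw [hcj] at hs
    obtain ⟨t, ⟨htN, ht, -⟩, s, ⟨hsN, -, hs⟩, hts, hne0⟩ := exists_common_point (hstrict i) hs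
      (hzero i) (hzero j) (hne i) hc hm (hre i) (hre j)
      (hN'.and (((hγ0 i).eventually hleft).and ((hγ0 j).eventually hleft)))
    have heq : γ i t = γ j s := by rw [← ht, ← hs, hts]
    have hmem : γ i t ∈ ({0} : Set ℂ) := hNd ⟨⟨t, htN, rfl⟩, ⟨s, hsN, heq.symm⟩⟩
    exact hne0 (by rw [Set.mem_singleton_iff.1 hmem, hφ0])
  have hcard := Finset.card_le_card_of_injOn (s := Finset.univ)
    (t := (Polynomial.nthRoots m (-1 : ℂ)).toFinset) ε (fun i _ => by
      rw [Finset.mem_coe, Multiset.mem_toFinset, Polynomial.mem_nthRoots (by omega)]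
      exact sq_normalized_pow_eq_neg_one (hne i)
        (re_pow_deriv_eq_zero (hstrict i).hasDerivAt (hzero i) (hre i))) hinj.injOn
  rw [Finset.card_univ, Fintype.card_fin] at hcard
  exact hcard.trans ((Multiset.toFinset_card_le _).trans (Polynomial.card_nthRoots m _))

/-- The tangent and the curvature at `0` of a nodal curve of `Re (z^n H)`. -/
theorem IsNodalArc.exists_tangent {u : ℂ → ℝ} {γ : ℝ → ℂ} (hγ : IsNodalArc u 0 γ) {n : ℕ}
    (hn : 1 ≤ n) {H : ℂ → ℂ} {H' : ℂ} (hH : HasDerivAt H H' 0) (h0 : H 0 ≠ 0)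
    (hu : ∀ᶠ z in 𝓝 (0 : ℂ), u z = (z ^ n * H z).re) :
    ∃ v : ℂ, ‖v‖ = 1 ∧ (H 0 * v ^ n).re = 0 ∧ (v * (H' / H 0)).im = n / 2 * |planeCurvature γ 0| := by
  obtain ⟨hγ0, hγa, hγd, hγu⟩ := hγ
  -- Writing γ(t) = t g(t) gives u(γ(t)) = t^n Re(g^n H(γ)). After division by t^n, the value at t =
  -- 0 yields the tangent condition and the first derivative the curvature.
  have hg : AnalyticAt ℝ (dslope γ 0) 0 := by
    obtain ⟨p, hp⟩ := hγa
    exact ⟨_, hp.has_fpower_series_dslope_fslope⟩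
  set g := dslope γ 0 with hgdef
  have hγg : ∀ t, γ t = t * g t := fun t => by
    have := sub_smul_dslope γ 0 t
    rw [hγ0, sub_zero, sub_zero, Complex.real_smul] at this
    exact this.symm
  have hg0 : g 0 = deriv γ 0 := dslope_same _ _
  have hd1 : ∀ᶠ t in 𝓝 (0 : ℝ), deriv γ t = g t + t * deriv g t := by
    filter_upwards [hg.eventually_analyticAt] with t ht
    have h1 : HasDerivAt (fun t : ℝ => (t : ℂ) * g t) (1 * g t + t * deriv g t) t :=
      (Complex.ofRealCLM.hasDerivAt (x := t)).mul ht.differentiableAt.hasDerivAt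
    rw [show γ = fun t : ℝ => (t : ℂ) * g t from funext hγg, h1.deriv, one_mul]
  have hd2 : deriv (deriv γ) 0 = 2 * deriv g 0 := by
    have h1 : HasDerivAt (fun t : ℝ => g t + t * deriv g t)
        (deriv g 0 + (1 * deriv g 0 + ((0 : ℝ) : ℂ) * deriv (deriv g) 0)) 0 :=
      hg.differentiableAt.hasDerivAt.add
        ((Complex.ofRealCLM.hasDerivAt (x := 0)).mul hg.deriv.differentiableAt.hasDerivAt)
    rw [Filter.EventuallyEq.deriv_eq hd1, h1.deriv]
    simp; ring
  set v := deriv γ 0 with hv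
  have hinner : HasDerivAt γ v 0 := hγa.differentiableAt.hasDerivAt
  have hF : HasDerivAt (fun t : ℝ => g t ^ n * H (γ t))
      (n * v ^ (n - 1) * deriv g 0 * H 0 + v ^ n * (v * H')) 0 := by
    have h1 : HasDerivAt (fun t => H (γ t)) (v * H') 0 := by
      rw [← hγ0] at hH
      exact hH.scomp (0 : ℝ) hinner
    have h2 := (hg.differentiableAt.hasDerivAt.pow n).mul h1
    rw [Pi.pow_apply, hg0, hγ0] at h2
    exact h2
  have hF0 : ∀ᶠ t in 𝓝[≠] (0 : ℝ), (g t ^ n * H (γ t)).re = 0 := by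
    have ht : Tendsto γ (𝓝 0) (𝓝 0) := by
      have := hinner.continuousAt.tendsto
      rwa [hγ0] at this
    filter_upwards [nhdsWithin_le_nhds hγu, nhdsWithin_le_nhds (ht.eventually hu),
      self_mem_nhdsWithin] with t h1 h2 h3
    have h4 : (γ t ^ n * H (γ t)) = ((t ^ n : ℝ) : ℂ) * (g t ^ n * H (γ t)) := by
      rw [hγg t]; push_cast; ring
    rw [h1, h4, Complex.re_ofReal_mul] at h2
    exact (mul_eq_zero.1 h2.symm).resolve_left (pow_ne_zero _ h3)
  have hFr : HasDerivAt (fun t : ℝ => (g t ^ n * H (γ t)).re)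
      (n * v ^ (n - 1) * deriv g 0 * H 0 + v ^ n * (v * H')).re 0 :=
    Complex.reCLM.hasFDerivAt.comp_hasDerivAt 0 hF
  have hre0 : (v ^ n * H 0).re = 0 := by
    have h1 := hFr.continuousAt.tendsto.mono_left (nhdsWithin_le_nhds (s := {0}ᶜ))
    have h2 := tendsto_nhds_unique h1 (tendsto_const_nhds.congr' (hF0.mono fun t ht => ht.symm))
    rwa [hg0, hγ0] at h2
  have hre1 : (n * v ^ (n - 1) * deriv g 0 * H 0 + v ^ n * (v * H')).re = 0 := by
    have : (fun t : ℝ => (g t ^ n * H (γ t)).re) =ᶠ[𝓝 0] fun _ => 0 := by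
      rw [eventually_nhdsWithin_iff] at hF0
      filter_upwards [hF0] with t ht
      by_cases h : t = 0
      · rw [h, hg0, hγ0, hre0]
      · exact ht h
    rw [← hFr.deriv, this.deriv_eq, deriv_const]
  -- The derivative is the purely imaginary nonzero number v^n H(0) times this expression. Its real
  -- part can vanish only if the imaginary part of the expression does.
  have him : (n * (deriv g 0 / v) + v * (H' / H 0)).im = 0 := by
    have h1 : n * v ^ (n - 1) * deriv g 0 * H 0 + v ^ n * (v * H')
        = (v ^ n * H 0) * (n * (deriv g 0 / v) + v * (H' / H 0)) := by
      obtain ⟨k, rfl⟩ : ∃ k, n = k + 1 := ⟨n - 1, by omega⟩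
      field_simp
      simp only [Nat.add_sub_cancel, pow_succ]
      ring
    have h2 : (v ^ n * H 0).im ≠ 0 := fun h =>
      mul_ne_zero (pow_ne_zero n hγd) h0 (Complex.ext hre0 h)
    rw [h1, Complex.mul_re, hre0, zero_mul, zero_sub, neg_eq_zero] at hre1
    exact (mul_eq_zero.1 hre1).resolve_left h2
  have hvn : ‖v‖ ≠ 0 := norm_ne_zero_iff.2 hγd
  have hcurv : planeCurvature γ 0 * ‖v‖ = 2 * (deriv g 0 / v).im := by
    rw [planeCurvature, hd2, Complex.div_im, Complex.normSq_eq_norm_sq]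
    simp only [Complex.mul_re, Complex.mul_im, Complex.re_ofNat, Complex.im_ofNat]
    rw [← hv]
    field_simp
    ring
  have hmain : (v / ‖v‖ * (H' / H 0)).im = -(n / 2 * planeCurvature γ 0) := by
    rw [div_mul_eq_mul_div, Complex.div_ofReal_im, div_eq_iff hvn, neg_mul, mul_assoc, hcurv]
    rw [Complex.add_im, Complex.mul_im] at him
    simp only [Complex.natCast_re, Complex.natCast_im, zero_mul, add_zero] at him
    linarith
  have hunit : ‖v / ‖v‖‖ = 1 := by
    rw [norm_div, Complex.norm_real, norm_norm, div_self hvn]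
  have htan : (H 0 * (v / ‖v‖) ^ n).re = 0 := by
    rw [div_pow, ← mul_div_assoc, ← Complex.ofReal_pow, Complex.div_ofReal_re, mul_comm, hre0,
      zero_div]
  -- Reversing v preserves the tangent condition and flips the sign of the imaginary part, so the
  -- absolute value of the curvature can be reached.
  rcases le_total 0 (planeCurvature γ 0) with hκ | hκ
  · refine ⟨-(v / ‖v‖), by rw [norm_neg, hunit], ?_, ?_⟩
    · rw [neg_pow, mul_left_comm]
      rcases neg_one_pow_eq_or ℂ n with h | h <;> rw [h] <;> simp [htan]
    · rw [neg_mul, Complex.neg_im, hmain, abs_of_nonneg hκ, neg_neg]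
  · refine ⟨v / ‖v‖, hunit, htan, ?_⟩
    rw [hmain, abs_of_nonpos hκ]; ring

/-! ### Extremal sums of unit complex numbers with prescribed product -/

/-- The constant 17/10 lies between π/2, forced at d = π, and √3 = cot(π/6), the largest value that
`cos_lt_tangent` allows. In terms of the half angle e, the bound follows from e ≤ tan e when tan e ≤
17/10, and from cos e ≤ π/2 - e otherwise. -/
theorem sub_sin_le_mul_one_sub_cos {d : ℝ} (h0 : 0 ≤ d) (hd : d ≤ Real.pi) :
    d - Real.sin d ≤ 17 / 10 * (1 - Real.cos d) := by
  obtain ⟨e, rfl⟩ : ∃ e, d = 2 * e := ⟨d / 2, by ring⟩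
  have he0 : 0 ≤ e := by linarith
  have he : e ≤ Real.pi / 2 := by linarith
  have hs0 : 0 ≤ Real.sin e := Real.sin_nonneg_of_nonneg_of_le_pi he0 (by linarith)
  have hc0 : 0 ≤ Real.cos e := Real.cos_nonneg_of_neg_pi_div_two_le_of_le (by linarith) he
  have hsq := Real.sin_sq_add_cos_sq e
  have hs1 := Real.sin_le_one e
  have key : e - Real.sin e * Real.cos e ≤ 17 / 10 * Real.sin e ^ 2 := by
    by_cases h : Real.sin e ≤ 17 / 10 * Real.cos e
    · have hc : 0 < Real.cos e := by
        rcases hc0.lt_or_eq with h1 | h1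
        · exact h1
        · rw [← h1] at h hsq; nlinarith
      have hlt : e < Real.pi / 2 := by
        rcases he.lt_or_eq with h1 | h1
        · exact h1
        · rw [h1, Real.cos_pi_div_two] at hc; exact absurd hc (lt_irrefl _)
      have htan := Real.le_tan he0 hlt
      rw [Real.tan_eq_sin_div_cos, le_div_iff₀ hc] at htan
      have h3 : (e - Real.sin e * Real.cos e) * Real.cos e
          ≤ 17 / 10 * Real.sin e ^ 2 * Real.cos e := by
        nlinarith [mul_nonneg (sq_nonneg (Real.sin e)) (sub_nonneg.2 h)]
      exact le_of_mul_le_mul_right h3 hc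
    · push Not at h
      have h1 : Real.cos e ≤ Real.pi / 2 - e := by
        rw [← Real.sin_pi_div_two_sub]; exact Real.sin_le (by linarith)
      have h2 := Real.pi_lt_d2
      nlinarith [mul_nonneg hs0 hc0]
  rw [Real.sin_two_mul, Real.cos_two_mul]
  nlinarith

/-- Cosine is not concave on all of [0, π], yet its tangent at a ≤ π/6 stays above it there. With y
= a + d the gap is cos a (1 - cos d) - sin a (d - sin d), positive for d > 0 because cot a ≥ √3 >
17/10. The restriction on a is the source of N ≥ 6 below. -/
theorem cos_lt_tangent {a y : ℝ} (ha0 : 0 < a) (ha : a ≤ Real.pi / 6) (hy0 : 0 ≤ y)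
    (hy : y ≤ Real.pi) (hne : y ≠ a) :
    Real.cos y < Real.cos a - Real.sin a * (y - a) := by
  obtain ⟨d, rfl⟩ : ∃ d, y = a + d := ⟨y - a, by ring⟩
  have hpi := Real.pi_pos
  have hd0 : d ≠ 0 := fun h => hne (by rw [h, add_zero])
  have hsa : 0 < Real.sin a := Real.sin_pos_of_pos_of_lt_pi ha0 (by linarith)
  have hsa2 : Real.sin a ≤ 1 / 2 := by
    rw [← Real.sin_pi_div_six]
    exact Real.sin_le_sin_of_le_of_le_pi_div_two (by linarith) (by linarith) ha
  have hca : 0 < Real.cos a := Real.cos_pos_of_mem_Ioo ⟨by linarith, by linarith⟩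
  have hcs : 17 / 10 * Real.sin a < Real.cos a := by
    have := Real.sin_sq_add_cos_sq a
    by_contra! h
    nlinarith
  have hcd : Real.cos d < 1 := by
    refine lt_of_le_of_ne (Real.cos_le_one d) fun h => hd0 ?_
    exact (Real.cos_eq_one_iff_of_lt_of_lt (by linarith) (by linarith)).1 h
  rw [Real.cos_add, add_sub_cancel_left]
  rcases lt_or_gt_of_ne hd0 with h | h
  · have := Real.sin_le (x := -d) (by linarith)
    rw [Real.sin_neg] at this
    nlinarith [mul_pos hca (sub_pos.2 hcd)]
  · have := sub_sin_le_mul_one_sub_cos h.le (by linarith)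
    nlinarith [mul_pos (sub_pos.2 hcs) (sub_pos.2 hcd)]

theorem cos_le_tangent {a y : ℝ} (ha0 : 0 < a) (ha : a ≤ Real.pi / 6) (hy0 : 0 ≤ y)
    (hy : y ≤ Real.pi) : Real.cos y ≤ Real.cos a - Real.sin a * (y - a) := by
  by_cases h : y = a
  · rw [h]; simp
  · exact (cos_lt_tangent ha0 ha hy0 hy h).le

/-- Among `N ≥ 6` complex numbers of modulus one with product `-1`, the real part of the sum is
maximal only if they all agree with `e^{iπ/N}` or all agree with `e^{-iπ/N}`. -/
theorem eq_exp_of_prod_eq_neg_one {ι : Type*} [Fintype ι] {N : ℕ} (hN : Fintype.card ι = N)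
    (hN6 : 6 ≤ N) (z : ι → ℂ) (hz : ∀ i, ‖z i‖ = 1) (hprod : ∏ i, z i = -1)
    (hsum : N * Real.cos (Real.pi / N) ≤ ∑ i, (z i).re) :
    ∃ l : ℤ, (l = 1 ∨ l = -1) ∧ ∀ i, z i = Complex.exp (Complex.I * (l * (Real.pi / N) : ℝ)) := by
  have hNpos : (0 : ℝ) < N := by exact_mod_cast (by omega : 0 < N)
  have hN6' : (6 : ℝ) ≤ N := by exact_mod_cast hN6
  have hpi := Real.pi_pos
  set a := Real.pi / N with ha
  have ha0 : 0 < a := by positivity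
  have ha6 : a ≤ Real.pi / 6 := div_le_div_of_nonneg_left hpi.le (by norm_num) hN6'
  have hNa : N * a = Real.pi := by rw [ha]; field_simp
  have hze : ∀ i, z i = Complex.exp (Complex.I * (z i).arg) := fun i => by
    conv_lhs => rw [← Complex.norm_mul_exp_arg_mul_I (z i), hz i]
    rw [Complex.ofReal_one, one_mul, mul_comm]
  have hre : ∀ i, (z i).re = Real.cos |(z i).arg| := fun i => by
    rw [Real.cos_abs]
    conv_lhs => rw [hze i, mul_comm, Complex.exp_ofReal_mul_I_re]
  have hsa : 0 < Real.sin a := Real.sin_pos_of_pos_of_lt_pi ha0 (by linarith)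
  -- Since the product is -1, the sum of the arguments is an odd multiple of π.
  have hodd : Real.pi ≤ |∑ i, (z i).arg| := by
    have h1 : Complex.exp (Complex.I * (∑ i, (z i).arg : ℝ)) = Complex.exp (Real.pi * Complex.I) := by
      rw [Complex.exp_pi_mul_I, ← hprod, Finset.prod_congr rfl fun i _ => hze i,
        ← Complex.exp_sum, ← Finset.mul_sum]
      push_cast; rfl
    obtain ⟨k, hk⟩ := Complex.exp_eq_exp_iff_exists_int.1 h1
    have h2 : (((∑ i, (z i).arg : ℝ)) : ℂ) = ((Real.pi + k * (2 * Real.pi) : ℝ) : ℂ) := by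
      apply mul_left_cancel₀ Complex.I_ne_zero
      rw [hk]; push_cast; ring
    rw [Complex.ofReal_inj] at h2
    rw [h2]
    rcases le_or_gt 0 k with h | h
    · have : (0 : ℝ) ≤ k := by exact_mod_cast h
      exact le_trans (by nlinarith) (le_abs_self _)
    · have : (k : ℝ) ≤ -1 := by exact_mod_cast (by omega : k ≤ -1)
      exact le_trans (by nlinarith) (neg_le_abs _)
  have hle : Real.pi ≤ ∑ i, |(z i).arg| := hodd.trans (Finset.abs_sum_le_sum_abs _ _)
  have hcard : ((Finset.univ : Finset ι).card : ℝ) = N := by rw [Finset.card_univ, hN]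
  -- Summing the tangent inequality at a = π/N bounds the sum by N cos a, because the absolute
  -- arguments add up to at least π = N a. Equality must then hold in every term.
  have htan : ∀ i ∈ Finset.univ, Real.cos |(z i).arg|
      ≤ Real.cos a - Real.sin a * (|(z i).arg| - a) := fun i _ =>
    cos_le_tangent ha0 ha6 (abs_nonneg _) (Complex.abs_arg_le_pi _)
  have htot : ∑ i, (Real.cos a - Real.sin a * (|(z i).arg| - a))
      = N * Real.cos a - Real.sin a * (∑ i, |(z i).arg| - Real.pi) := by
    rw [Finset.sum_sub_distrib, ← Finset.mul_sum, Finset.sum_sub_distrib, Finset.sum_const,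
      Finset.sum_const, nsmul_eq_mul, nsmul_eq_mul, hcard, hNa]
  have hsum' : N * Real.cos a ≤ ∑ i, Real.cos |(z i).arg| := by
    simpa only [hre] using hsum
  have hge : ∑ i, (Real.cos a - Real.sin a * (|(z i).arg| - a)) ≤ ∑ i, Real.cos |(z i).arg| := by
    rw [htot]; nlinarith
  have heq := (Finset.sum_eq_sum_iff_of_le htan).1 (le_antisymm (Finset.sum_le_sum htan) hge)
  have habs : ∀ i, |(z i).arg| = a := fun i => by
    by_contra h
    exact (cos_lt_tangent ha0 ha6 (abs_nonneg _) (Complex.abs_arg_le_pi _) h).ne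
      (heq i (Finset.mem_univ i))
  -- All arguments are now ±a while their sum has absolute value at least N a, so they share one
  -- sign s.
  have hconst : ∀ s : ℝ, (∀ i, s * (z i).arg ≤ a) → Real.pi ≤ ∑ i, s * (z i).arg →
      ∀ i, s * (z i).arg = a := by
    intro s hs hpi i
    have h1 : ∑ i, s * (z i).arg ≤ ∑ _i : ι, a := Finset.sum_le_sum fun i _ => hs i
    have h2 : ∑ _i : ι, a = Real.pi := by
      rw [Finset.sum_const, nsmul_eq_mul, hcard, hNa]
    exact (Finset.sum_eq_sum_iff_of_le fun i _ => hs i).1 (le_antisymm h1 (h2 ▸ hpi)) i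
      (Finset.mem_univ i)
  rcases le_abs.1 hodd with h | h
  · refine ⟨1, Or.inl rfl, fun i => ?_⟩
    have := hconst 1 (fun i => by rw [one_mul]; exact (le_abs_self _).trans (habs i).le)
      (by simpa only [one_mul] using h) i
    rw [one_mul] at this
    rw [hze i, this]; simp
  · refine ⟨-1, Or.inr rfl, fun i => ?_⟩
    have := hconst (-1) (fun i => by rw [neg_one_mul]; exact (neg_le_abs _).trans (habs i).le)
      (by rw [← Finset.mul_sum, neg_one_mul]; exact h) i
    rw [neg_one_mul] at this
    have h3 : (z i).arg = -a := by linarith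
    rw [hze i, h3]; simp

/-! ### Positivity of pT and its first moments -/

/-- The monic polynomial with the roots `e^{iθ_j}`. -/
noncomputable def rootPolynomial {n : ℕ} (θ : Fin (2 * n) → ℝ) : Polynomial ℂ :=
  ∏ i, (Polynomial.X - Polynomial.C (Complex.exp (Complex.I * θ i)))

theorem rootPolynomial_monic {n : ℕ} (θ : Fin (2 * n) → ℝ) : (rootPolynomial θ).Monic :=
  Polynomial.monic_prod_X_sub_C _ _

theorem rootPolynomial_natDegree {n : ℕ} (θ : Fin (2 * n) → ℝ) :
    (rootPolynomial θ).natDegree = 2 * n := by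
  rw [rootPolynomial, Polynomial.natDegree_finsetProd_X_sub_C_eq_card, Finset.card_univ,
    Fintype.card_fin]

theorem rootPolynomial_coeff_top {n : ℕ} (θ : Fin (2 * n) → ℝ) :
    (rootPolynomial θ).coeff (2 * n) = 1 := by
  rw [← rootPolynomial_natDegree θ]; exact rootPolynomial_monic θ

theorem rootPolynomial_coeff_zero {n : ℕ} (θ : Fin (2 * n) → ℝ) :
    (rootPolynomial θ).coeff 0 = ∏ i, Complex.exp (Complex.I * θ i) := by
  rw [Polynomial.coeff_zero_eq_eval_zero, rootPolynomial, Polynomial.eval_prod]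
  simp [Finset.prod_neg]

theorem rootPolynomial_coeff_pred {n : ℕ} (hn : 1 ≤ n) (θ : Fin (2 * n) → ℝ) :
    (rootPolynomial θ).coeff (2 * n - 1) = -∑ i, Complex.exp (Complex.I * θ i) := by
  have h := Polynomial.prod_X_sub_C_nextCoeff (s := Finset.univ)
    fun i => Complex.exp (Complex.I * θ i)
  rw [← h, ← rootPolynomial, Polynomial.nextCoeff_of_natDegree_pos, rootPolynomial_natDegree]
  rw [rootPolynomial_natDegree]; omega

/-- The trigonometric polynomial `p` of degree `n` with zeros `θ_j` has a nonnegative product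
with the distribution `T`. -/
structure IsTrigMultiplier (T : CircleDistribution) {n : ℕ} (θ : Fin (2 * n) → ℝ) (A : ℂ)
    (p : SmoothCircle) : Prop where
  norm_eq : ‖A‖ = 1
  sq_mul_prod : A ^ 2 * ∏ i, Complex.exp (Complex.I * θ i) = 1
  apply_eq : ∀ x : ℝ, (((p : ℝ → ℝ) x : ℝ) : ℂ) = A * Complex.exp (-(Complex.I * n * x))
    * ∏ i, (Complex.exp (Complex.I * x) - Complex.exp (Complex.I * θ i))
  nonneg : ∀ f : SmoothCircle, (∀ x : ℝ, 0 ≤ (f : ℝ → ℝ) x) → 0 ≤ T (p * f)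

theorem re_ofReal_mul (p : SmoothCircle) (f : ComplexSmoothCircle) :
    re (ofReal p * f) = p * re f := by
  ext x
  show ((((p : ℝ → ℝ) x : ℝ) : ℂ) * (f : ℝ → ℂ) x).re = _
  rw [Complex.re_ofReal_mul]; rfl

theorem im_ofReal_mul (p : SmoothCircle) (f : ComplexSmoothCircle) :
    im (ofReal p * f) = p * im f := by
  ext x
  show ((((p : ℝ → ℝ) x : ℝ) : ℂ) * (f : ℝ → ℂ) x).im = _
  rw [Complex.im_ofReal_mul]; rfl

theorem complexify_ofReal_mul (T : CircleDistribution) (p : SmoothCircle)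
    (f : ComplexSmoothCircle) :
    T.complexify (ofReal p * f) = T (p * re f) + Complex.I * T (p * im f) := by
  rw [← re_ofReal_mul, ← im_ofReal_mul]; rfl

/-- The function `x ↦ cos (x - φ)`. -/
noncomputable def cosShift (φ : ℝ) : SmoothCircle :=
  re (Complex.exp (-(Complex.I * φ)) • exp 1)

theorem cosShift_apply (φ x : ℝ) : (cosShift φ : ℝ → ℝ) x = Real.cos (x - φ) := by
  rw [cosShift, re_apply, smul_apply, exp_apply, ← Complex.exp_add,
    show -(Complex.I * φ) + Complex.I * ((1 : ℤ) : ℂ) * x = ((x - φ : ℝ) : ℂ) * Complex.I by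
      push_cast; ring, Complex.exp_ofReal_mul_I_re]

/-- Hadamard's lemma gives h(x) - h(φ) = O(x - φ), and 1 - cos is bounded below by a multiple of the
square on a period. This lets 1 - cos(x - φ) control every test function near φ. -/
theorem exists_sq_le_one_sub_cos (h : SmoothCircle) (φ : ℝ) :
    ∃ C : ℝ, ∀ x, ((h : ℝ → ℝ) x - (h : ℝ → ℝ) φ) ^ 2 ≤ C * (1 - Real.cos (x - φ)) := by
  have hs : ContDiff ℝ ∞ fun x => (h : ℝ → ℝ) x - (h : ℝ → ℝ) φ := h.2.1.sub contDiff_const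
  obtain ⟨F, hF, hFe, -⟩ := exists_contDiff_eq_pow_mul 1 hs (φ := φ) (by simp)
  obtain ⟨B, hB⟩ := (isCompact_Icc (a := φ - Real.pi) (b := φ + Real.pi)).exists_bound_of_continuousOn
    hF.continuous.continuousOn
  have hpi := Real.pi_pos
  refine ⟨B ^ 2 * (Real.pi ^ 2 / 2), fun x => ?_⟩
  obtain ⟨y, k, hy, rfl⟩ : ∃ (y : ℝ) (k : ℤ), y ∈ Set.Ico (φ - Real.pi) (φ - Real.pi + 2 * Real.pi)
      ∧ x = y + k • (2 * Real.pi) :=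
    ⟨_, _, toIcoMod_mem_Ico Real.two_pi_pos _ x,
      (toIcoMod_add_toIcoDiv_zsmul Real.two_pi_pos (φ - Real.pi) x).symm⟩
  have hcos : Real.cos (y + k • (2 * Real.pi) - φ) = Real.cos (y - φ) := by
    rw [add_sub_right_comm]; exact Real.cos_periodic.zsmul k _
  rw [h.2.2.zsmul k, hcos, hFe, pow_one, mul_pow]
  have hyB := hB y ⟨hy.1, by linarith [hy.2]⟩
  have h1 : F y ^ 2 ≤ B ^ 2 := by
    rw [← sq_abs]
    exact pow_le_pow_left₀ (abs_nonneg _) hyB 2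
  have h4 := Real.cos_le_one (y - φ)
  have h2 := Real.cos_le_one_sub_mul_cos_sq (x := y - φ)
    (abs_le.2 ⟨by linarith [hy.1], by linarith [hy.2]⟩)
  have h3 : (y - φ) ^ 2 ≤ Real.pi ^ 2 / 2 * (1 - Real.cos (y - φ)) := by
    have : 2 / Real.pi ^ 2 * (y - φ) ^ 2 ≤ 1 - Real.cos (y - φ) := by linarith
    rw [div_mul_eq_mul_div, div_le_iff₀ (by positivity)] at this
    linarith
  calc (y - φ) ^ 2 * F y ^ 2 ≤ (Real.pi ^ 2 / 2 * (1 - Real.cos (y - φ))) * B ^ 2 :=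
        mul_le_mul h3 h1 (sq_nonneg _) (mul_nonneg (by positivity) (by linarith))
    _ = _ := by ring

namespace IsTrigMultiplier

variable {T : CircleDistribution} {n : ℕ} {θ : Fin (2 * n) → ℝ} {A : ℂ} {p : SmoothCircle}

theorem mul_conj (h : IsTrigMultiplier T θ A p) : A * (starRingEnd ℂ) A = 1 := by
  rw [Complex.mul_conj', h.norm_eq]; simp

/-- The unimodular normalization of A links the lowest and the highest coefficient of p by
conjugation, as the reality of p requires. -/
theorem mul_coeff_zero (h : IsTrigMultiplier T θ A p) :
    A * (rootPolynomial θ).coeff 0 = (starRingEnd ℂ) A := by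
  have hA : A ≠ 0 := by rintro rfl; simpa using h.norm_eq
  apply mul_left_cancel₀ hA
  rw [h.mul_conj, rootPolynomial_coeff_zero, ← mul_assoc, ← sq, h.sq_mul_prod]

theorem ofReal_eq_sum (h : IsTrigMultiplier T θ A p) : ofReal p
    = ∑ j ∈ Finset.range (2 * n + 1), (A * (rootPolynomial θ).coeff j) • exp (j - n) := by
  ext x
  rw [ofReal_apply, h.apply_eq, sum_apply]
  have h1 : ∏ i, (Complex.exp (Complex.I * x) - Complex.exp (Complex.I * θ i))
      = (rootPolynomial θ).eval (Complex.exp (Complex.I * x)) := by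
    rw [rootPolynomial, Polynomial.eval_prod]; simp
  rw [h1, Polynomial.eval_eq_sum_range, rootPolynomial_natDegree, Finset.mul_sum]
  refine Finset.sum_congr rfl fun j _ => ?_
  rw [smul_apply, exp_apply, ← Complex.exp_nat_mul,
    show Complex.I * (((j : ℤ) - (n : ℤ) : ℤ) : ℂ) * x
      = -(Complex.I * n * x) + j * (Complex.I * x) by push_cast; ring, Complex.exp_add]
  ring

theorem complexify_mul_exp (h : IsTrigMultiplier T θ A p) (k : ℤ) :
    T.complexify (ofReal p * exp k)
      = A * ∑ j ∈ Finset.range (2 * n + 1), (rootPolynomial θ).coeff j * T.fourier (n - j - k) := by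
  rw [h.ofReal_eq_sum, Finset.sum_mul, map_sum, Finset.mul_sum]
  refine Finset.sum_congr rfl fun j _ => ?_
  rw [smul_mul_assoc, map_smul, ← exp_add, CircleDistribution.fourier, smul_eq_mul, mul_assoc]
  congr 4
  ring

/-- The frequencies of p lie in [-n, n], and only the two extreme ones meet nonzero Fourier
coefficients of `T`. -/
theorem complexify_eq (h : IsTrigMultiplier T θ A p) (hn : 1 ≤ n)
    (hF : ∀ k : ℤ, |k| < n → T.fourier k = 0) :
    T.complexify (ofReal p) = A * (starRingEnd ℂ) (T.fourier n) + (starRingEnd ℂ) A * T.fourier n := by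
  have h1 := h.complexify_mul_exp 0
  rw [exp_zero, mul_one, Finset.sum_range_succ, Finset.sum_eq_single_of_mem 0, rootPolynomial_coeff_top,
    mul_add, ← mul_assoc, h.mul_coeff_zero, one_mul,
    show (n : ℤ) - ((2 * n : ℕ) : ℤ) - 0 = -n by push_cast; ring,
    T.fourier_neg] at h1
  · rw [h1]; simp; ring
  · exact Finset.mem_range.2 (by omega)
  · intro j hj hj0
    rw [Finset.mem_range] at hj
    rw [hF _ (by rw [abs_lt]; omega), mul_zero]

theorem apply_eq_two_mul_re (h : IsTrigMultiplier T θ A p) (hn : 1 ≤ n)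
    (hF : ∀ k : ℤ, |k| < n → T.fourier k = 0) :
    T p = 2 * ((starRingEnd ℂ) A * T.fourier n).re := by
  have h1 := congrArg Complex.re (h.complexify_eq hn hF)
  rw [T.complexify_re] at h1
  have h2 : re (ofReal p) = p := by ext x; rfl
  rw [h2] at h1
  rw [h1, Complex.add_re, Complex.mul_re, Complex.mul_re]
  simp
  ring

/-- After a shift by one frequency, exactly the two top coefficients of p survive; the second one is
minus the sum of the roots. -/
theorem complexify_mul_exp_one (h : IsTrigMultiplier T θ A p) (hn : 1 ≤ n)
    (hF : ∀ k : ℤ, |k| < n → T.fourier k = 0) :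
    T.complexify (ofReal p * exp 1) = A * ((starRingEnd ℂ) (T.fourier (n + 1))
      - (∑ i, Complex.exp (Complex.I * θ i)) * (starRingEnd ℂ) (T.fourier n)) := by
  have hr : Finset.range (2 * n) = insert (2 * n - 1) (Finset.range (2 * n - 1)) := by
    rw [← Finset.range_add_one]; congr 1; omega
  rw [h.complexify_mul_exp, Finset.sum_range_succ, rootPolynomial_coeff_top, hr,
    Finset.sum_insert Finset.notMem_range_self, Finset.sum_eq_zero,
    rootPolynomial_coeff_pred hn θ,
    show (n : ℤ) - ((2 * n - 1 : ℕ) : ℤ) - 1 = -n by omega,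
    show (n : ℤ) - ((2 * n : ℕ) : ℤ) - 1 = -(n + 1) by omega, T.fourier_neg,
    T.fourier_neg]
  · ring
  · intro j hj
    rw [Finset.mem_range] at hj
    rw [hF _ (by rw [abs_lt]; omega), mul_zero]

/-- A positive functional of total mass zero vanishes: test it on B ± f, where B bounds |f|. -/
theorem apply_mul_eq_zero (h : IsTrigMultiplier T θ A p) (h0 : T p = 0) (f : SmoothCircle) :
    T (p * f) = 0 := by
  obtain ⟨B, hB⟩ := exists_bound_iteratedDeriv (ofReal f) 0
  have hB' : ∀ x, |(f : ℝ → ℝ) x| ≤ B := fun x => by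
    simpa [ofReal_apply] using hB 0 le_rfl x
  have h1 := h.nonneg (B • 1 - f) fun x => by
    show 0 ≤ B * 1 - (f : ℝ → ℝ) x
    linarith [le_abs_self ((f : ℝ → ℝ) x), hB' x]
  have h2 := h.nonneg (B • 1 + f) fun x => by
    show 0 ≤ B * 1 + (f : ℝ → ℝ) x
    linarith [neg_abs_le ((f : ℝ → ℝ) x), hB' x]
  rw [mul_sub, mul_smul_comm, mul_one, map_sub, map_smul, h0] at h1
  rw [mul_add, mul_smul_comm, mul_one, map_add, map_smul, h0] at h2
  simp only [smul_eq_mul, mul_zero] at h1 h2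
  linarith

/-- The equation pT = 0 is a linear recursion for the Fourier coefficients. Its coefficient of t_m
is nonzero, and for m > n the other indices are smaller than m and at least -n. -/
theorem fourier_eq_zero (h : IsTrigMultiplier T θ A p)
    (h0 : T p = 0) (hF : ∀ k : ℤ, |k| ≤ n → T.fourier k = 0) (m : ℕ) : T.fourier m = 0 := by
  induction m using Nat.strong_induction_on with
  | _ m ih =>
    by_cases hm : m ≤ n
    · exact hF m (by rw [abs_le]; omega)
    · have h1 := h.complexify_mul_exp (n - m)
      rw [complexify_ofReal_mul, h.apply_mul_eq_zero h0, h.apply_mul_eq_zero h0,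
        Finset.sum_eq_single_of_mem 0, ← mul_assoc, h.mul_coeff_zero] at h1
      · have hA : (starRingEnd ℂ) A ≠ 0 := fun hA => by simpa [hA] using h.mul_conj
        rw [show (n : ℤ) - ((0 : ℕ) : ℤ) - (n - m) = m by push_cast; ring] at h1
        simpa [hA] using h1.symm
      · simp
      · intro j hj hj0
        rw [Finset.mem_range] at hj
        have : T.fourier (n - j - (n - m)) = 0 := by
          by_cases hjm : j ≤ m
          · rw [show (n : ℤ) - j - (n - m) = ((m - j : ℕ) : ℤ) by omega]
            exact ih _ (by omega)
          · exact hF _ (by rw [abs_le]; omega)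
        rw [this, mul_zero]

/-- A positive functional annihilating 1 - cos(x - φ), which vanishes only at φ on the circle, is a
point mass there. -/
theorem apply_mul_eq (h : IsTrigMultiplier T θ A p) {φ : ℝ} (h0 : T (p * (1 - cosShift φ)) = 0)
    (f : SmoothCircle) : T (p * f) = (f : ℝ → ℝ) φ * T p := by
  obtain ⟨C, hC⟩ := exists_sq_le_one_sub_cos f φ
  have hp0 : 0 ≤ T p := by
    have := h.nonneg 1 fun x => zero_le_one
    rwa [mul_one] at this
  have key : ∀ s : ℝ, s ^ 2 = 1 → ∀ ε > 0,
      0 ≤ ε * T p + s * (T (p * f) - (f : ℝ → ℝ) φ * T p) := by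
    intro s hs ε hε
    -- Nonnegativity comes from completing the square: ε + sD + D²/(4ε) = (2ε + sD)²/(4ε) with D = f
    -- - f(φ) and s² = 1, the quadratic term being dominated by the multiple of 1 - cos.
    have h1 := h.nonneg (ε • 1 + s • (f - (f : ℝ → ℝ) φ • 1) + (C / (4 * ε)) • (1 - cosShift φ))
      fun x => by
        show 0 ≤ ε * 1 + s * ((f : ℝ → ℝ) x - (f : ℝ → ℝ) φ * 1)
          + C / (4 * ε) * (1 - (cosShift φ : ℝ → ℝ) x)
        rw [cosShift_apply, mul_one, mul_one]
        have h2 : ((f : ℝ → ℝ) x - (f : ℝ → ℝ) φ) ^ 2 / (4 * ε)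
            ≤ C / (4 * ε) * (1 - Real.cos (x - φ)) := by
          rw [div_mul_eq_mul_div]
          exact div_le_div_of_nonneg_right (hC x) (by positivity)
        have h3 : 0 ≤ ε + s * ((f : ℝ → ℝ) x - (f : ℝ → ℝ) φ)
            + ((f : ℝ → ℝ) x - (f : ℝ → ℝ) φ) ^ 2 / (4 * ε) := by
          have : ε + s * ((f : ℝ → ℝ) x - (f : ℝ → ℝ) φ)
              + ((f : ℝ → ℝ) x - (f : ℝ → ℝ) φ) ^ 2 / (4 * ε)
              = (2 * ε + s * ((f : ℝ → ℝ) x - (f : ℝ → ℝ) φ)) ^ 2 / (4 * ε) := by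
            rw [add_sq, mul_pow s, hs]; field_simp; ring
          rw [this]; positivity
        linarith
    rw [mul_add, mul_add, mul_smul_comm, mul_smul_comm, mul_smul_comm, map_add, map_add, map_smul,
      map_smul, map_smul, h0, mul_sub, mul_smul_comm, mul_one, map_sub, map_smul] at h1
    simpa using h1
  by_contra hne
  have hd : T (p * f) - (f : ℝ → ℝ) φ * T p ≠ 0 := sub_ne_zero.2 hne
  set D := T (p * f) - (f : ℝ → ℝ) φ * T p
  have hD : 0 < |D| := abs_pos.2 hd
  -- The summand 1 keeps the denominator positive when T(p) = 0.
  have hε : 0 < |D| / (2 * (T p + 1)) := by positivity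
  have hlt : |D| / (2 * (T p + 1)) * T p < |D| := by
    rw [div_mul_eq_mul_div, div_lt_iff₀ (by positivity)]
    nlinarith
  rcases abs_cases D with hc | hc
  · have := key (-1) (by norm_num) _ hε; linarith
  · have := key 1 (by norm_num) _ hε; linarith

end IsTrigMultiplier

/-! ### The equality case of the curvature estimate -/

theorem curvatureBound_mul {n : ℕ} (hn : 1 ≤ n) (he : Even n) :
    n / 2 * curvatureBound n = (2 * n + 2 : ℕ) * Real.cos (Real.pi / (2 * n + 2 : ℕ)) := by
  have : (n : ℝ) ≠ 0 := by exact_mod_cast (by omega : n ≠ 0)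
  rw [curvatureBound, if_pos he]
  push_cast
  rw [show (2 * (n : ℝ) + 2) = 2 * (n + 1) by ring]
  field_simp
  ring

theorem curvatureBound_mul_of_odd {n : ℕ} (hn : 1 ≤ n) (ho : Odd n) :
    n / 2 * curvatureBound n = (2 * n + 2 : ℕ) := by
  have : (n : ℝ) ≠ 0 := by exact_mod_cast (by omega : n ≠ 0)
  rw [curvatureBound, if_neg (Nat.not_even_iff_odd.2 ho)]
  push_cast
  field_simp
  ring

/-- The equality case of the sharp estimate for a sum of `2n + 2` unit complex numbers with
product `(-1)^(n+1)`. -/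
theorem eq_exp_of_curvatureBound_le {ι : Type*} [Fintype ι] {n : ℕ} (hn : 1 ≤ n)
    (hι : Fintype.card ι = 2 * n + 2) (z : ι → ℂ) (hz : ∀ i, ‖z i‖ = 1)
    (hprod : ∏ i, z i = (-1) ^ (n + 1)) (hsum : n / 2 * curvatureBound n ≤ ∑ i, (z i).re) :
    ∃ l : ℤ, (Odd n → l = 0) ∧ (Even n → l = 1 ∨ l = -1) ∧
      (∀ i, z i = Complex.exp (Complex.I * (l * (Real.pi / (2 * n + 2 : ℕ)) : ℝ))) ∧
      ∑ i, (z i).re = n / 2 * curvatureBound n := by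
  have hcard : ((Finset.univ : Finset ι).card : ℝ) = (2 * n + 2 : ℕ) := by
    rw [Finset.card_univ, hι]
  rcases Nat.even_or_odd n with he | ho
  · rw [curvatureBound_mul hn he] at hsum ⊢
    -- An even n ≥ 1 is at least 2, hence 2n + 2 ≥ 6.
    obtain ⟨l, hl, hzl⟩ := eq_exp_of_prod_eq_neg_one hι (by obtain ⟨k, rfl⟩ := he; omega) z hz
      (by rw [hprod, he.add_one.neg_one_pow]) hsum
    refine ⟨l, fun ho => absurd he (Nat.not_even_iff_odd.2 ho), fun _ => hl, hzl, ?_⟩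
    have hre : ∀ i, (z i).re = Real.cos (Real.pi / (2 * n + 2 : ℕ)) := fun i => by
      rw [hzl i, mul_comm, Complex.exp_ofReal_mul_I_re]
      rcases hl with rfl | rfl <;> simp
    simp only [hre]
    rw [Finset.sum_const, nsmul_eq_mul, hcard]
  · rw [curvatureBound_mul_of_odd hn ho] at hsum ⊢
    have hle : ∀ i ∈ Finset.univ, (z i).re ≤ 1 := fun i _ => (Complex.re_le_norm _).trans (hz i).le
    have hone : ∑ _i : ι, (1 : ℝ) = (2 * n + 2 : ℕ) := by
      rw [Finset.sum_const, nsmul_eq_mul, hcard, mul_one]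
    have heq := le_antisymm (Finset.sum_le_sum hle) (hone ▸ hsum)
    have hre := (Finset.sum_eq_sum_iff_of_le hle).1 heq
    refine ⟨0, fun _ => rfl, fun he => absurd he (Nat.not_even_iff_odd.2 ho), fun i => ?_,
      heq.trans hone⟩
    have h1 := hre i (Finset.mem_univ i)
    have h2 : (z i).im = 0 := by
      have := Complex.sq_norm (z i)
      rw [hz i, Complex.normSq_apply, h1] at this
      nlinarith
    rw [show z i = 1 from Complex.ext h1 h2]
    simp

/-- The number is purely imaginary of modulus ‖t‖. Squaring removes its unknown sign, which suffices
because σ enters the product below twice. -/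
theorem sq_pow_of_re_eq_zero {t v : ℂ} {n : ℕ} (hv : ‖v‖ = 1) (h : (t * v ^ n).re = 0) :
    (t * v ^ n) ^ 2 = -(‖t‖ : ℂ) ^ 2 := by
  have h1 : t * v ^ n = (t * v ^ n).im * Complex.I := Complex.ext (by simp [h]) (by simp)
  have h2 : (t * v ^ n).im ^ 2 = ‖t‖ ^ 2 := by
    have : ‖t * v ^ n‖ ^ 2 = ‖t‖ ^ 2 := by rw [norm_mul, norm_pow, hv, one_pow, mul_one]
    rw [← this, Complex.sq_norm, Complex.normSq_apply, h]; ring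
  rw [h1, mul_pow, Complex.I_sq]
  have h3 : (((t * v ^ n).im : ℂ)) ^ 2 = (‖t‖ : ℂ) ^ 2 := by exact_mod_cast h2
  rw [h3]; ring

namespace IsTrigMultiplier

variable {T : CircleDistribution} {n : ℕ} {θ : Fin (2 * n) → ℝ} {A : ℂ} {p : SmoothCircle}

theorem apply_mul_one_sub_cosShift (h : IsTrigMultiplier T θ A p) (hn : 1 ≤ n)
    (hF : ∀ k : ℤ, |k| < n → T.fourier k = 0) (φ : ℝ) :
    T (p * (1 - cosShift φ)) = 2 * ((starRingEnd ℂ) A * T.fourier n).re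
      - (Complex.exp (Complex.I * φ) * ((starRingEnd ℂ) A * (T.fourier (n + 1)
        - (starRingEnd ℂ) (∑ i, Complex.exp (Complex.I * θ i)) * T.fourier n))).re := by
  rw [mul_sub, mul_one, map_sub, h.apply_eq_two_mul_re hn hF, cosShift, ← re_ofReal_mul,
    ← T.complexify_re, mul_smul_comm, map_smul, h.complexify_mul_exp_one hn hF, smul_eq_mul]
  congr 1
  rw [← Complex.conj_re]
  congr 1
  simp only [map_mul, map_sub, Complex.conj_conj, ← Complex.exp_conj, map_neg, Complex.conj_I,
    Complex.conj_ofReal, neg_mul, neg_neg]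

/-- The rigidity of the extremal configuration: all zeros of the trigonometric multiplier
coincide. -/
theorem exists_of_extremal (h : IsTrigMultiplier T θ A p) (hn : 1 ≤ n)
    (hF : ∀ k : ℤ, |k| < n → T.fourier k = 0) (ht : T.fourier n ≠ 0) {v : ℂ} (hv : ‖v‖ = 1)
    (htan : (T.fourier n * v ^ n).re = 0)
    (hcurv : (v * (T.fourier (n + 1) / T.fourier n)).im = n / 2 * curvatureBound n) :
    ∃ (l : ℤ) (φ : ℝ), (Odd n → l = 0) ∧ (Even n → l = 1 ∨ l = -1) ∧
      (∀ i, Complex.exp (Complex.I * θ i) = Complex.exp (Complex.I * φ)) ∧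
      (starRingEnd ℂ) A * T.fourier n = ‖T.fourier n‖
        * Complex.exp (Complex.I * (l * (Real.pi / (2 * n + 2 : ℕ)) : ℝ)) ∧
      T (p * (1 - cosShift φ)) = 0 := by
  set t := T.fourier n with htdef
  have htn : 0 < ‖t‖ := norm_pos_iff.2 ht
  have htc : (‖t‖ : ℂ) ≠ 0 := by exact_mod_cast htn.ne'
  set σ : ℂ := (starRingEnd ℂ) A * t / ‖t‖ with hσ
  have hσt : (starRingEnd ℂ) A * t = ‖t‖ * σ := by rw [hσ]; field_simp
  have hσn : ‖σ‖ = 1 := by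
    rw [hσ, norm_div, norm_mul, Complex.norm_conj, h.norm_eq, Complex.norm_real, norm_norm,
      one_mul, div_self htn.ne']
  have hσ0 : σ ≠ 0 := fun h0 => by rw [h0] at hσn; simp at hσn
  -- This direction is chosen so that τσ = -iv, which turns the real part in the positivity
  -- inequality into the imaginary part that encodes the curvature.
  set τ : ℂ := -Complex.I * v / σ with hτ
  have hτn : ‖τ‖ = 1 := by
    rw [hτ, norm_div, norm_mul, norm_neg, Complex.norm_I, hv, hσn]; norm_num
  have hτe : Complex.exp (Complex.I * τ.arg) = τ := by
    conv_rhs => rw [← Complex.norm_mul_exp_arg_mul_I τ, hτn]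
    rw [Complex.ofReal_one, one_mul, mul_comm]
  set e : Fin (2 * n) → ℂ := fun i => Complex.exp (Complex.I * θ i) with he
  have hen : ∀ i, ‖e i‖ = 1 := fun i => by
    rw [he, Complex.norm_exp]; simp
  set z : Fin (2 * n) → ℂ := fun i => -Complex.I * v * (starRingEnd ℂ) (e i) with hz
  have hzre : ∀ i, (z i).re = (v * (starRingEnd ℂ) (e i)).im := fun i => by
    rw [hz]
    show (-Complex.I * v * (starRingEnd ℂ) (e i)).re = _
    rw [mul_assoc, neg_mul, Complex.neg_re, Complex.I_mul_re, neg_neg]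
  -- Since the left side is nonnegative, this identity is the curvature estimate itself: (n/2)|κ| is
  -- at most the sum of the Re z_i plus 2 Re σ.
  have hpair : T (p * (1 - cosShift τ.arg))
      = ‖t‖ * (∑ i, (z i).re + 2 * σ.re - n / 2 * curvatureBound n) := by
    rw [h.apply_mul_one_sub_cosShift hn hF, hτe, ← htdef, hσt, Complex.re_ofReal_mul]
    have h1 : τ * ((starRingEnd ℂ) A * (T.fourier (n + 1) - (starRingEnd ℂ) (∑ i, e i) * t))
        = ‖t‖ * (-Complex.I * (v * (T.fourier (n + 1) / t)
          - ∑ i, v * (starRingEnd ℂ) (e i))) := by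
      have h2 : τ * σ = -Complex.I * v := by rw [hτ]; field_simp
      have h3 : (starRingEnd ℂ) A * (T.fourier (n + 1) - (starRingEnd ℂ) (∑ i, e i) * t)
          = ((starRingEnd ℂ) A * t) * (T.fourier (n + 1) / t - (starRingEnd ℂ) (∑ i, e i)) := by
        field_simp
      rw [h3, hσt, ← Finset.mul_sum, ← map_sum, ← mul_assoc, ← mul_sub, ← mul_assoc (-Complex.I),
        ← h2]
      ring
    rw [h1, Complex.re_ofReal_mul, neg_mul, Complex.neg_re, Complex.I_mul_re, neg_neg,
      Complex.sub_im, hcurv, Complex.im_sum, Finset.sum_congr rfl fun i _ => hzre i]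
    ring
  have hnonneg : 0 ≤ T (p * (1 - cosShift τ.arg)) := h.nonneg _ fun x => by
    show 0 ≤ 1 - (cosShift τ.arg : ℝ → ℝ) x
    rw [cosShift_apply]; linarith [Real.cos_le_one (x - τ.arg)]
  -- The unit number σ counts twice, for the term 2 Re σ coming from T(p).
  let w : Fin (2 * n) ⊕ Fin 2 → ℂ := Sum.elim z fun _ => σ
  have hwsum : ∑ i, (w i).re = ∑ i, (z i).re + 2 * σ.re := by
    simp [w, Fintype.sum_sum_type]
  -- The normalization of A expresses the product of the roots, and the tangent condition fixes (t
  -- v^n)²; together they eliminate A, v and t.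
  have hprod : ∏ i, w i = (-1) ^ (n + 1) := by
    have h1 : ∏ i, w i = (∏ i, z i) * σ ^ 2 := by simp [w, Fintype.prod_sum_type]
    have h2 : (starRingEnd ℂ) (∏ i, e i) = A ^ 2 := by
      have h3 : (starRingEnd ℂ) A ^ 2 * (starRingEnd ℂ) (∏ i, e i) = 1 := by
        rw [← map_pow, ← map_mul, h.sq_mul_prod, map_one]
      have h4 : A ^ 2 * (starRingEnd ℂ) A ^ 2 = 1 := by rw [← mul_pow, h.mul_conj, one_pow]
      calc _ = (A ^ 2 * (starRingEnd ℂ) A ^ 2) * (starRingEnd ℂ) (∏ i, e i) := by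
            rw [h4, one_mul]
        _ = _ := by rw [mul_assoc, h3, mul_one]
    have h3 : ∏ i, z i = (-1) ^ n * v ^ (2 * n) * A ^ 2 := by
      rw [Finset.prod_mul_distrib, Finset.prod_const, Finset.card_univ, Fintype.card_fin,
        ← map_prod, h2, mul_pow, pow_mul (-Complex.I)]
      simp
    have h5 : A ^ 2 * (‖t‖ * σ) ^ 2 = t ^ 2 := by
      rw [← hσt, ← mul_pow, ← mul_assoc, h.mul_conj, one_mul]
    have h6 := sq_pow_of_re_eq_zero hv htan
    rw [mul_pow, ← h5, mul_pow, ← pow_mul, mul_comm n 2] at h6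
    have h7 : v ^ (2 * n) * A ^ 2 * σ ^ 2 = -1 := by
      apply mul_left_cancel₀ (pow_ne_zero 2 htc)
      linear_combination h6
    rw [h1, h3, pow_succ]
    linear_combination (-1) ^ n * h7
  obtain ⟨l, hodd, heven, hw, hsum⟩ := eq_exp_of_curvatureBound_le hn (by simp) w
    (by
      rintro (i | i)
      · show ‖-Complex.I * v * (starRingEnd ℂ) (e i)‖ = 1
        rw [norm_mul, norm_mul, norm_neg, Complex.norm_I, hv, Complex.norm_conj, hen]; norm_num
      · exact hσn) hprod (by
      rw [hpair] at hnonneg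
      rw [hwsum]
      have := nonneg_of_mul_nonneg_right hnonneg htn
      linarith)
  have hσl := hw (Sum.inr 0)
  have hzl : ∀ i, z i = σ := fun i => (hw (Sum.inl i)).trans hσl.symm
  refine ⟨l, τ.arg, hodd, heven, fun i => ?_, ?_, ?_⟩
  · rw [hτe, hτ, eq_div_iff hσ0, ← hzl i]
    show e i * (-Complex.I * v * (starRingEnd ℂ) (e i)) = _
    have : e i * (starRingEnd ℂ) (e i) = 1 := by rw [Complex.mul_conj', hen]; simp
    linear_combination (-Complex.I * v) * this
  · rw [hσt]; congr 1
  · rw [hpair, ← hwsum, hsum, sub_self, mul_zero]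

end IsTrigMultiplier

/-! ### Reconstruction of T from the point mass pT -/

theorem CircleDistribution.tail_neg_eq (T : CircleDistribution) {n : ℕ}
    (hF : ∀ k : ℤ, |k| < n → T.fourier k = 0) {z : ℂ} (hz : ‖z‖ < 1) (k : ℕ) (hk : k < n) :
    T.tail (-k) z = z ^ k * T.tail 0 z := by
  induction k with
  | zero => simp
  | succ k ih =>
    rw [T.tail_eq_add _ hz, hF _ (by rw [abs_lt]; omega),
      show -((k + 1 : ℕ) : ℤ) + 1 = -k by push_cast; ring, ih (by omega), pow_succ]
    ring

theorem CircleDistribution.pow_mul_tail (T : CircleDistribution) {n : ℕ}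
    (hF : ∀ k : ℤ, |k| < n → T.fourier k = 0) {z : ℂ} (hz : ‖z‖ < 1) (j : ℕ) (hj : j < 2 * n) :
    z ^ n * T.tail (n - j) z = z ^ j * T.tail 0 z := by
  by_cases hjn : j ≤ n
  · rw [T.tail_zero_eq (n - j) (fun k hk => hF k (by rw [abs_lt]; omega)) hz, Nat.cast_sub hjn,
      ← mul_assoc, ← pow_add, Nat.add_sub_cancel' hjn]
  · rw [show (n : ℤ) - j = -((j - n : ℕ) : ℤ) by omega, T.tail_neg_eq hF hz _ (by omega),
      ← mul_assoc, ← pow_add, Nat.add_sub_cancel' (by omega)]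

/-- Only this top shift reaches down to the frequency -n and picks up the extra coefficient
conj(t_n). -/
theorem CircleDistribution.pow_mul_tail_top (T : CircleDistribution) {n : ℕ} (hn : 1 ≤ n)
    (hF : ∀ k : ℤ, |k| < n → T.fourier k = 0) {z : ℂ} (hz : ‖z‖ < 1) :
    z ^ n * T.tail (n - (2 * n : ℕ)) z = z ^ (2 * n) * T.tail 0 z
      + z ^ n * ((starRingEnd ℂ) (T.fourier n) / Real.pi) := by
  obtain ⟨m, rfl⟩ : ∃ m, n = m + 1 := ⟨n - 1, by omega⟩
  rw [show ((m + 1 : ℕ) : ℤ) - (2 * (m + 1) : ℕ) = -((m + 1 : ℕ) : ℤ) by push_cast; ring,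
    T.tail_eq_add _ hz, T.fourier_neg, show -((m + 1 : ℕ) : ℤ) + 1 = -m by push_cast; ring,
    T.tail_neg_eq hF hz m (by omega)]
  ring

theorem iteratedDeriv_circleTranslate (α : ℝ) (f : SmoothCircle) (j : ℕ) (x : ℝ) :
    iteratedDeriv j (circleTranslate α f : ℝ → ℝ) x = iteratedDeriv j (f : ℝ → ℝ) (x + α) :=
  congrFun (iteratedDeriv_comp_add_const j (f : ℝ → ℝ) α) x

/-- The sign (-1)^j of the distributional derivative cancels the sign from differentiating e^{-ikx}.
-/
theorem diracDeriv_complexify (j : ℕ) (k : ℤ) (φ : ℝ) :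
    ((diracDeriv j φ (re (exp (-k))) : ℝ) : ℂ) + Complex.I * (diracDeriv j φ (im (exp (-k))) : ℝ)
      = (Complex.I * k) ^ j * Complex.exp (-(Complex.I * k * φ)) := by
  have h1 : diracDeriv j φ (re (exp (-k)))
      = (-1) ^ j * (iteratedDeriv j (exp (-k) : ℝ → ℂ) φ).re := by
    have := congrFun (iteratedDeriv_clm (L := Complex.reCLM) (exp (-k)).2.1 j) φ
    exact congrArg ((-1 : ℝ) ^ j * ·) this
  have h2 : diracDeriv j φ (im (exp (-k)))
      = (-1) ^ j * (iteratedDeriv j (exp (-k) : ℝ → ℂ) φ).im := by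
    have := congrFun (iteratedDeriv_clm (L := Complex.imCLM) (exp (-k)).2.1 j) φ
    exact congrArg ((-1 : ℝ) ^ j * ·) this
  have h3 : iteratedDeriv j (exp (-k) : ℝ → ℂ) φ
      = (Complex.I * ((-k : ℤ) : ℂ)) ^ j * Complex.exp (-(Complex.I * k * φ)) := by
    rw [iteratedDeriv_exp]
    show (Complex.I * ((-k : ℤ) : ℂ)) ^ j * (exp (-k) : ℝ → ℂ) φ = _
    rw [exp_apply]; push_cast; ring_nf
  rw [h1, h2]
  push_cast
  calc _ = (-1) ^ j * (((iteratedDeriv j (exp (-k) : ℝ → ℂ) φ).re : ℂ)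
        + (iteratedDeriv j (exp (-k) : ℝ → ℂ) φ).im * Complex.I) := by ring
    _ = _ := by
      rw [Complex.re_add_im, h3, ← mul_assoc, ← mul_pow]; push_cast; ring

theorem diracDeriv_one (j : ℕ) (φ : ℝ) : diracDeriv j φ 1 = if j = 0 then 1 else 0 := by
  show (-1) ^ j * iteratedDeriv j (fun _ => (1 : ℝ)) φ = _
  rw [iteratedDeriv_const]
  split_ifs with h <;> simp [h]

theorem complexify_circleTranslate (T : CircleDistribution) (α : ℝ) (k : ℤ) :
    (T (circleTranslate (-α) (re (exp (-k)))) : ℂ)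
      + Complex.I * T (circleTranslate (-α) (im (exp (-k))))
      = Complex.exp (Complex.I * k * α) * T.fourier k := by
  have h : ∀ x : ℝ, (exp (-k) : ℝ → ℂ) (x + -α)
      = Complex.exp (Complex.I * k * α) * (exp (-k) : ℝ → ℂ) x := fun x => by
    rw [exp_apply, exp_apply, ← Complex.exp_add]; push_cast; ring_nf
  have h1 : circleTranslate (-α) (re (exp (-k)))
      = re (Complex.exp (Complex.I * k * α) • exp (-k)) := by
    ext x; exact congrArg Complex.re (h x)
  have h2 : circleTranslate (-α) (im (exp (-k)))
      = im (Complex.exp (Complex.I * k * α) • exp (-k)) := by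
    ext x; exact congrArg Complex.im (h x)
  rw [h1, h2, CircleDistribution.fourier]
  exact T.complexify.map_smul (Complex.exp (Complex.I * k * α)) (exp (-k))

/-- A linear functional which vanishes whenever the derivatives up to order `N` vanish at `φ` is a
combination of derivatives of the Dirac mass at `φ`. -/
theorem exists_eq_sum_diracDeriv {L : SmoothCircle →ₗ[ℝ] ℝ} {φ : ℝ} {N : ℕ}
    (hL : ∀ f : SmoothCircle, (∀ j ≤ N, iteratedDeriv j (f : ℝ → ℝ) φ = 0) → L f = 0)
    (h1 : L 1 = 0) : ∃ b : ℕ → ℝ, L = ∑ j ∈ Finset.Icc 1 N, b j • diracDeriv j φ := by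
  have hmem : L ∈ Submodule.span ℝ (Set.range fun j : Fin (N + 1) => diracDeriv j φ) := by
    -- Finite-dimensional duality: a functional vanishing on the common kernel of finitely many
    -- functionals is in their span.
    refine mem_span_of_iInf_ker_le_ker fun f hf => hL f fun j hj => ?_
    have := (Submodule.mem_iInf _).1 hf ⟨j, by omega⟩
    have h2 : (-1 : ℝ) ^ j * iteratedDeriv j (f : ℝ → ℝ) φ = 0 := this
    exact (mul_eq_zero.1 h2).resolve_left (pow_ne_zero _ (by norm_num))
  obtain ⟨b, hb⟩ := (Submodule.mem_span_range_iff_exists_fun ℝ).1 hmem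
  let b' : ℕ → ℝ := fun j => if h : j < N + 1 then b ⟨j, h⟩ else 0
  have hsum : L = ∑ j ∈ Finset.range (N + 1), b' j • diracDeriv j φ := by
    rw [← hb, ← Fin.sum_univ_eq_sum_range fun j => b' j • diracDeriv j φ]
    exact Finset.sum_congr rfl fun j _ => by simp only [b', j.2, dite_true]
  have hb0 : b' 0 = 0 := by
    rw [hsum, LinearMap.sum_apply, Finset.sum_eq_single_of_mem 0 (by simp)] at h1
    · simpa [diracDeriv_one] using h1
    · intro j _ hj; simp [diracDeriv_one, hj]
  refine ⟨b', hsum.trans ?_⟩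
  rw [Finset.range_eq_Ico, Finset.sum_eq_sum_Ico_succ_bot (by omega), hb0, zero_smul, zero_add]
  rfl

namespace IsTrigMultiplier

variable {T : CircleDistribution} {n : ℕ} {θ : Fin (2 * n) → ℝ} {A : ℂ} {p : SmoothCircle} {φ : ℝ}

theorem complexify_mul (h : IsTrigMultiplier T θ A p) (h0 : T (p * (1 - cosShift φ)) = 0)
    (f : ComplexSmoothCircle) : T.complexify (ofReal p * f) = (f : ℝ → ℂ) φ * T p := by
  rw [complexify_ofReal_mul, h.apply_mul_eq h0, h.apply_mul_eq h0, re_apply, im_apply]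
  push_cast
  conv_rhs => rw [← Complex.re_add_im ((f : ℝ → ℂ) φ)]
  ring

/-- Evaluate pT = T(p) δ_φ on the Cauchy kernel. Expanding p gives shifted power series, and the gap
|k| < n reduces them after multiplication by z^n to the series for u, up to one boundary term. -/
theorem eval_mul_tail (h : IsTrigMultiplier T θ A p) (hn : 1 ≤ n)
    (hF : ∀ k : ℤ, |k| < n → T.fourier k = 0) (h0 : T (p * (1 - cosShift φ)) = 0) {z : ℂ}
    (hz : ‖z‖ < 1) :
    A * (rootPolynomial θ).eval z * (Real.pi * T.tail 0 z)
      = z ^ n * ((1 - z * Complex.exp (-(Complex.I * φ)))⁻¹ * T p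
        - A * (starRingEnd ℂ) (T.fourier n)) := by
  have hpi : (Real.pi : ℂ) ≠ 0 := by exact_mod_cast Real.pi_ne_zero
  have h1 := h.complexify_mul h0 (cauchy z hz)
  rw [cauchy_apply, exp_apply, show Complex.I * ((-1 : ℤ) : ℂ) * φ = -(Complex.I * φ) by
    push_cast; ring] at h1
  have h2 : T.complexify (ofReal p * cauchy z hz)
      = Real.pi * A * ∑ j ∈ Finset.range (2 * n + 1), (rootPolynomial θ).coeff j
        * T.tail (n - j) z := by
    rw [h.ofReal_eq_sum, Finset.sum_mul, map_sum, Finset.mul_sum]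
    refine Finset.sum_congr rfl fun j _ => ?_
    rw [smul_mul_assoc, map_smul, T.tail_eq _ hz, neg_sub, smul_eq_mul]
    field_simp
  rw [← h1, h2, Polynomial.eval_eq_sum_range, rootPolynomial_natDegree, Finset.sum_range_succ,
    Finset.sum_range_succ, rootPolynomial_coeff_top]
  have h3 : z ^ n * ∑ j ∈ Finset.range (2 * n), (rootPolynomial θ).coeff j * T.tail (n - j) z
      = (∑ j ∈ Finset.range (2 * n), (rootPolynomial θ).coeff j * z ^ j) * T.tail 0 z := by
    rw [Finset.mul_sum, Finset.sum_mul]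
    refine Finset.sum_congr rfl fun j hj => ?_
    rw [mul_left_comm, T.pow_mul_tail hF hz j (Finset.mem_range.1 hj)]; ring
  have h4 := T.pow_mul_tail_top hn hF hz
  have h5 : (Real.pi : ℂ) * ((starRingEnd ℂ) (T.fourier n) / Real.pi)
      = (starRingEnd ℂ) (T.fourier n) := mul_div_cancel₀ _ hpi
  linear_combination (-Real.pi * A) * h3 - (Real.pi * A) * h4 - z ^ n * A * h5

/-- The sign of a trigonometric multiplier all whose zeros coincide. -/
theorem exists_sign (h : IsTrigMultiplier T θ A p)
    (he : ∀ i, Complex.exp (Complex.I * θ i) = Complex.exp (Complex.I * φ)) :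
    ∃ ε : ℝ, ε ^ 2 = 1 ∧ A * Complex.exp (Complex.I * φ) ^ n = ε := by
  have h1 : (A * Complex.exp (Complex.I * φ) ^ n) ^ 2 = 1 := by
    have := h.sq_mul_prod
    simp only [he, Finset.prod_const, Finset.card_univ, Fintype.card_fin] at this
    rw [mul_pow, ← pow_mul, mul_comm n 2, this]
  rcases sq_eq_sq_iff_eq_or_eq_neg.1 (h1.trans (one_pow 2).symm) with h2 | h2
  · exact ⟨1, by norm_num, by simpa using h2⟩
  · exact ⟨-1, by norm_num, by simpa using h2⟩

/-- Here p is, up to sign, (2 sin((x - φ)/2))^(2n). A function g vanishing to order 2n + 1 at φ is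
pK with K smooth and K(φ) = 0, so T(g) = K(φ) T(p) = 0. -/
theorem apply_eq_zero_of_iteratedDeriv_eq_zero (h : IsTrigMultiplier T θ A p)
    (he : ∀ i, Complex.exp (Complex.I * θ i) = Complex.exp (Complex.I * φ))
    (h0 : T (p * (1 - cosShift φ)) = 0) (g : SmoothCircle)
    (hg : ∀ j ≤ 2 * n, iteratedDeriv j (g : ℝ → ℝ) φ = 0) : T g = 0 := by
  obtain ⟨ε, hε, hAε⟩ := h.exists_sign he
  have hε0 : ε ≠ 0 := by rintro rfl; norm_num at hε
  have hp : ∀ x, (p : ℝ → ℝ) x = ε * (-1) ^ n * (2 * Real.sin ((x - φ) / 2)) ^ (2 * n) := by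
    intro x
    have h1 := h.apply_eq x
    simp only [he, Finset.prod_const, Finset.card_univ, Fintype.card_fin] at h1
    have h2 : ((((p : ℝ → ℝ) x : ℝ)) : ℂ)
        = ((ε * (-1) ^ n * (2 * Real.sin ((x - φ) / 2)) ^ (2 * n) : ℝ) : ℂ) := by
      rw [h1, Complex.ofReal_mul, Complex.ofReal_pow (2 * _), two_mul_sin_half, Complex.ofReal_mul,
        ← hAε, mul_pow, mul_pow, ← Complex.exp_nat_mul, ← Complex.exp_nat_mul,
        show ((2 * n : ℕ) : ℂ) * -(Complex.I * (x + φ) / 2)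
          = -(Complex.I * n * x) + -(n * (Complex.I * φ)) by push_cast; ring, Complex.exp_add,
        Complex.exp_neg (n * (Complex.I * φ)), pow_mul (-Complex.I)]
      have h3 := Complex.exp_ne_zero (n * (Complex.I * φ))
      have h4 : ((-1 : ℂ) ^ n) * (-1) ^ n = 1 := by rw [← mul_pow]; simp
      have h5 : (-Complex.I) ^ 2 = -1 := by simp
      rw [h5]
      push_cast
      field_simp
      rw [sq, h4, mul_one]
    exact_mod_cast h2
  obtain ⟨S, hS, hS0, hSe⟩ := exists_two_mul_sin_half_eq φ
  obtain ⟨G, hG, hGe, hG0⟩ := exists_contDiff_eq_pow_mul (2 * n) g.2.1 (φ := φ)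
    fun j hj => hg j hj.le
  rw [hg _ le_rfl, zero_div] at hG0
  have hloc : HasLocalQuotient (g : ℝ → ℝ) (p : ℝ → ℝ) φ 0 := by
    refine ⟨2 * n, G, fun x => ε * (-1) ^ n * S x ^ (2 * n), hG,
      contDiff_const.mul (hS.pow _), hGe, fun x => ?_, ?_, ?_⟩
    · rw [hp, hSe, mul_pow]; ring
    · exact mul_ne_zero (mul_ne_zero hε0 (pow_ne_zero _ (by norm_num))) (pow_ne_zero _ hS0)
    · rw [hG0, zero_div]
  obtain ⟨K, hK, hKv⟩ := exists_eq_mul_of_hasLocalQuotient g p fun x _ hx => by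
    have h1 : Real.sin ((x - φ) / 2) = 0 := by
      rw [hp] at hx
      have := (mul_eq_zero.1 hx).resolve_left (mul_ne_zero hε0 (pow_ne_zero _ (by norm_num)))
      have := eq_zero_of_pow_eq_zero this
      linarith
    obtain ⟨k, hk⟩ := Real.sin_eq_zero_iff.1 h1
    refine ⟨0, ?_⟩
    rw [show x = φ + k • (2 * Real.pi) by rw [zsmul_eq_mul]; linarith]
    exact hloc.translate (g.2.2.zsmul k) (p.2.2.zsmul k)
  rw [hK, h.apply_mul_eq h0, hKv φ 0 hloc, zero_mul]

end IsTrigMultiplier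

/-- The rational identity between the recursion and the extremal function. -/
theorem extremalFunction_eq {n : ℕ} {φ₀ : ℝ} {z s : ℂ}
    (hs : Complex.exp (Complex.I * (n * φ₀ : ℝ)) = s)
    (hq : 1 - Complex.exp (-(Complex.I * φ₀)) * z ≠ 0) :
    extremalFunction n φ₀ z * (1 - Complex.exp (-(Complex.I * φ₀)) * z) ^ (2 * n)
      = z ^ n * s⁻¹ * ((1 - Complex.exp (-(Complex.I * φ₀)) * z)⁻¹ * (s + s⁻¹) - s⁻¹) := by
  have hs0 : s ≠ 0 := hs ▸ Complex.exp_ne_zero _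
  set r := Complex.exp (-(Complex.I * φ₀)) with hr
  have h1 : Complex.exp (-(Complex.I * (n + 1) * φ₀)) = s⁻¹ * r := by
    rw [← hs, ← Complex.exp_neg, hr, ← Complex.exp_add]; push_cast; ring_nf
  have h2 : Complex.cos (n * φ₀) = (s + s⁻¹) / 2 := by
    rw [Complex.cos, ← hs, ← Complex.exp_neg]; push_cast; ring_nf
  rw [extremalFunction, h1, h2, ← hr, pow_succ (1 - r * z), pow_succ z]
  generalize hD : 1 - r * z = D at hq ⊢
  field_simp
  linear_combination (-(z ^ n * (s ^ 2 + 1))) * hD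

/-! ### From nodal curves to Fourier coefficients, and the conclusion -/

theorem fourier_eq_zero_of_abs_lt {T : CircleDistribution} {n : ℕ}
    (h : ∀ k : ℕ, k < n → T.fourier k = 0) (k : ℤ) (hk : |k| < n) : T.fourier k = 0 := by
  rw [abs_lt] at hk
  rcases Int.natAbs_eq k with h1 | h1
  · rw [h1]; exact h _ (by omega)
  · rw [h1, T.fourier_neg, h _ (by omega), map_zero]

/-- If `n` nodal curves meet at `0`, then the first Fourier coefficients vanish, but not all of
them do. -/
theorem NodalCurvesIntersectAt.fourier_eq_zero {T : CircleDistribution} {n : ℕ} (hn : 1 ≤ n)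
    (h : NodalCurvesIntersectAt (poissonExtension T) 0 n) :
    (∃ m : ℕ, T.fourier m ≠ 0) ∧ ∀ k : ℕ, k < n → T.fourier k = 0 := by
  have hball : ∀ᶠ z in 𝓝 (0 : ℂ), ‖z‖ < 1 := by
    filter_upwards [Metric.ball_mem_nhds (0 : ℂ) one_pos] with z hz using mem_ball_zero_iff.1 hz
  -- As n ≥ 1, some arc passes through 0, so u(0) = 0; and u(0) is T(1)/(2π).
  have hT1 : T 1 = 0 := by
    obtain ⟨γ, harc, -⟩ := h
    have h0 := (harc ⟨0, hn⟩).2.2.2.self_of_nhds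
    rw [(harc ⟨0, hn⟩).1, poissonExtension_eq T (by simp), T.tail_apply_zero, T.fourier_zero,
      Complex.div_ofReal_re, Complex.ofReal_re] at h0
    have hpi := Real.pi_ne_zero
    field_simp at h0
    linarith
  have hf0 : T.fourier 0 = 0 := by rw [T.fourier_zero, hT1, Complex.ofReal_zero]
  have hu : ∀ z : ℂ, ‖z‖ < 1 → poissonExtension T z = (T.tail 0 z).re := fun z hz => by
    rw [poissonExtension_eq T hz, hT1, zero_div, sub_zero]
  have hex : ∃ m : ℕ, T.fourier m ≠ 0 := by
    by_contra! hall
    refine h.not_eventually_eq_zero ?_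
    filter_upwards [hball] with z hz
    rw [hu z hz, CircleDistribution.tail]
    simp [hall]
  refine ⟨hex, fun k hk => ?_⟩
  classical
  have hm := Nat.find_spec hex
  have hlt : ∀ k < Nat.find hex, T.fourier k = 0 := fun k hk => by
    simpa using Nat.find_min hex hk
  set m := Nat.find hex
  have hm1 : 1 ≤ m := Nat.one_le_iff_ne_zero.2 fun h0 => hm (by rw [h0]; exact hf0)
  have hle : n ≤ m := h.le_order (T.analyticAt_tail m)
    (by rw [T.tail_apply_zero]; exact div_ne_zero hm (by exact_mod_cast Real.pi_ne_zero)) hm1 (by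
      filter_upwards [hball] with z hz
      rw [hu z hz, T.tail_zero_eq m (fun k hk => hlt k hk) hz])
  exact hlt k (by omega)

theorem mainTheorem2 (n : ℕ) (hn : 1 ≤ n) (T : CircleDistribution)
    (hT : AlmostChangesSign T (2 * n))
    (hu : NodalCurvesIntersectAt (poissonExtension T) 0 n)
    (hext : IsCurvatureExtremer (poissonExtension T) n) :
    ∃ (c α φ₀ : ℝ) (k : ℕ) (l : ℤ),
      c ≠ 0 ∧ k ≤ n - 1 ∧ (Odd n → l = 0) ∧ (Even n → l = 1 ∨ l = -1) ∧
      φ₀ = k * Real.pi / n + l * (Real.pi / (2 * n * (n + 1))) ∧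
      (∀ z : ℂ, ‖z‖ < 1 →
        c * poissonExtension T (Complex.exp (Complex.I * α) * z)
          = (extremalFunction n φ₀ z).re) ∧
      ∃ b : ℕ → ℝ,
        c • (T.toLinearMap ∘ₗ circleTranslate (-α))
          = ∑ j ∈ Finset.Icc 1 (2 * n), b j • diracDeriv j φ₀ ∧
        ∀ k ∈ Finset.Icc 1 n,
          1 / (Real.pi : ℂ) * ∑ j ∈ Finset.Icc 1 (2 * n),
            (b j : ℂ) * (Complex.I * k) ^ j * Complex.exp (-(Complex.I * k * φ₀))
          = if k = n then 1 else 0 := by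
  obtain ⟨⟨m, hm⟩, hlow⟩ := hu.fourier_eq_zero hn
  have hF := fourier_eq_zero_of_abs_lt hlow
  obtain ⟨θ, A, p, hA1, hA2, hA3, hA4⟩ := hT.exists_trigPolynomial
  have h : IsTrigMultiplier T θ A p := ⟨hA1, hA2, hA3, hA4⟩
  have hpi : (Real.pi : ℂ) ≠ 0 := by exact_mod_cast Real.pi_ne_zero
  -- If t_n = 0, then T(p) = 0, hence pT = 0, and the recursion makes every Fourier coefficient
  -- vanish.
  have ht : T.fourier n ≠ 0 := by
    intro h0
    refine hm (h.fourier_eq_zero ?_ (fun k hk => ?_) m)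
    · rw [h.apply_eq_two_mul_re hn hF, h0]; simp
    · exact fourier_eq_zero_of_abs_lt (n := n + 1) (fun k hk => by
        rcases Nat.lt_succ_iff_lt_or_eq.1 hk with h1 | h1
        · exact hlow k h1
        · rw [h1, h0]) k (by push_cast; omega)
  have hT1 : T 1 = 0 := by
    have := hlow 0 hn
    rw [Nat.cast_zero, T.fourier_zero] at this
    exact_mod_cast this
  have hu0 : ∀ z : ℂ, ‖z‖ < 1 → poissonExtension T z = (T.tail 0 z).re := fun z hz => by
    rw [poissonExtension_eq T hz, hT1, zero_div, sub_zero]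
  obtain ⟨γ, hγ, hκ⟩ := hext
  obtain ⟨v, hv, htan, hcurv⟩ := hγ.exists_tangent hn (T.hasDerivAt_tail n)
    (by rw [T.tail_apply_zero]; exact div_ne_zero ht hpi) (by
      filter_upwards [Metric.ball_mem_nhds (0 : ℂ) one_pos] with z hz
      rw [hu0 z (mem_ball_zero_iff.1 hz), T.tail_zero_eq n hlow (mem_ball_zero_iff.1 hz)])
  rw [T.tail_apply_zero, div_mul_eq_mul_div, Complex.div_ofReal_re, div_eq_zero_iff,
    or_iff_left Real.pi_ne_zero] at htan
  rw [T.tail_apply_zero, hκ, div_div_div_cancel_right₀ hpi] at hcurv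
  obtain ⟨l, φ, hodd, heven, he, hσ, h0⟩ := h.exists_of_extremal hn hF ht hv htan hcurv
  obtain ⟨ε, hε, hAε⟩ := h.exists_sign he
  have hε0 : ε ≠ 0 := by rintro rfl; norm_num at hε
  have htn : ‖T.fourier n‖ ≠ 0 := norm_ne_zero_iff.2 ht
  have htc : (‖T.fourier n‖ : ℂ) ≠ 0 := by exact_mod_cast htn
  have hn0 : (n : ℝ) ≠ 0 := by exact_mod_cast (by omega : n ≠ 0)
  -- The common value of the extremal unit numbers is s = e^{iβ}; the angle φ₀ of the normal form is
  -- β/n.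
  set β : ℝ := l * (Real.pi / (2 * n + 2 : ℕ)) with hβ
  set φ₀ : ℝ := l * (Real.pi / (2 * n * (n + 1))) with hφ₀
  have hnφ : n * φ₀ = β := by
    rw [hφ₀, hβ]; push_cast; field_simp
  set s : ℂ := Complex.exp (Complex.I * β) with hs
  set E : ℂ := Complex.exp (Complex.I * φ) with hE
  set r : ℂ := Complex.exp (-(Complex.I * φ₀)) with hr
  have hs0 : s ≠ 0 := Complex.exp_ne_zero _
  have hE0 : E ≠ 0 := Complex.exp_ne_zero _
  have hεc : (ε : ℂ) ^ 2 = 1 := by exact_mod_cast hε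
  have hrn : r ^ n = s⁻¹ := by
    rw [hr, hs, ← hnφ, ← Complex.exp_nat_mul, ← Complex.exp_neg]; push_cast; ring_nf
  have htA : T.fourier n = ‖T.fourier n‖ * (A * s) := by
    have := h.mul_conj
    linear_combination A * hσ - T.fourier n * this
  have hconj : A * (starRingEnd ℂ) (T.fourier n) = ‖T.fourier n‖ * s⁻¹ := by
    have h1 := congrArg (starRingEnd ℂ) hσ
    rw [map_mul, map_mul, Complex.conj_conj, Complex.conj_ofReal, hs, ← Complex.exp_conj, map_mul,
      Complex.conj_I, Complex.conj_ofReal, neg_mul, Complex.exp_neg] at h1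
    exact h1
  have hTp : (T p : ℂ) = ‖T.fourier n‖ * (s + s⁻¹) := by
    have h1 := h.complexify_eq hn hF
    have h2 : T.complexify (ofReal p) = T p := by
      have := h.complexify_mul h0 1
      rwa [mul_one, one_apply, one_mul] at this
    rw [h2, hconj, hσ] at h1
    rw [h1]; ring
  have hrot : ∀ k : ℤ, Complex.exp (Complex.I * k * (φ - φ₀ : ℝ)) = (E * r) ^ k := fun k => by
    rw [hE, hr, ← Complex.exp_add, ← Complex.exp_int_mul]; push_cast; ring_nf
  have hrot1 : Complex.exp (Complex.I * (φ - φ₀ : ℝ)) = E * r := by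
    have := hrot 1
    simpa using this
  -- The rotation moves the common zero φ of p to φ₀, so k = 0 always suffices. The factor ε π/‖t_n‖
  -- makes the leading coefficient of w equal to 1.
  refine ⟨ε * Real.pi / ‖T.fourier n‖, φ - φ₀, φ₀, 0, l,
    div_ne_zero (mul_ne_zero hε0 Real.pi_ne_zero) htn, Nat.zero_le _, hodd, heven, by simp [hφ₀],
    fun z hz => ?_, ?_⟩
  · have hz' : ‖E * r * z‖ < 1 := by
      rw [← hrot1, norm_mul, Complex.norm_exp]; simpa using hz
    have hEneg : Complex.exp (-(Complex.I * φ)) = E⁻¹ := Complex.exp_neg _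
    have hq : 1 - r * z ≠ 0 := by
      have := one_sub_mul_exp_ne_zero hz φ₀
      rwa [exp_apply, show Complex.I * ((-1 : ℤ) : ℂ) * φ₀ = -(Complex.I * φ₀) by push_cast; ring,
        mul_comm] at this
    have hroot : (rootPolynomial θ).eval (E * r * z) = E ^ (2 * n) * (1 - r * z) ^ (2 * n) := by
      rw [rootPolynomial, Polynomial.eval_prod]
      simp only [he, Polynomial.eval_sub, Polynomial.eval_X, Polynomial.eval_C, Finset.prod_const,
        Finset.card_univ, Fintype.card_fin]
      rw [← mul_pow, ← (even_two_mul n).neg_pow]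
      ring
    have h1 := h.eval_mul_tail hn hF h0 hz'
    have h2 := extremalFunction_eq (n := n) (φ₀ := φ₀) (z := z) (s := s) (by rw [hnφ]) hq
    rw [hroot, hEneg, hTp, hconj, show E * r * z * E⁻¹ = r * z by field_simp, mul_pow, mul_pow,
      hrn, pow_mul, pow_mul' (1 - r * z)] at h1
    rw [← hr, pow_mul'] at h2
    have hmain : ((ε * Real.pi / ‖T.fourier n‖ : ℝ) : ℂ) * T.tail 0 (E * r * z)
        = extremalFunction n φ₀ z := by
      -- Both sides are compared after clearing the denominator (1 - rz)^(2n): one is given by the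
      -- point-mass identity, the other by the closed form of the extremal function.
      apply mul_right_cancel₀ (pow_ne_zero 2 (pow_ne_zero n hq))
      rw [h2]
      have hEn : E ^ n ≠ 0 := pow_ne_zero n hE0
      push_cast
      have h3 : (E ^ n * ‖T.fourier n‖) * (ε * Real.pi / ‖T.fourier n‖ * T.tail 0 (E * r * z)
          * ((1 - r * z) ^ n) ^ 2) = (E ^ n * ‖T.fourier n‖) * (z ^ n * s⁻¹ *
            ((1 - r * z)⁻¹ * (s + s⁻¹) - s⁻¹)) := by
        have h4 : A * (E ^ 2) ^ n = ε * E ^ n := by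
          rw [← hAε, ← pow_mul, mul_comm 2 n, pow_mul]; ring
        rw [← mul_assoc A, h4] at h1
        have h5 : (E ^ n * (‖T.fourier n‖ : ℂ)) * (ε * Real.pi / ‖T.fourier n‖ * T.tail 0 (E * r * z)
          * ((1 - r * z) ^ n) ^ 2) = ε * E ^ n * ((1 - r * z) ^ n) ^ 2
            * (Real.pi * T.tail 0 (E * r * z)) := by field_simp
        rw [h5, h1]; ring
      exact mul_left_cancel₀ (mul_ne_zero hEn htc) h3
    rw [hrot1, hu0 _ hz', ← Complex.re_ofReal_mul, hmain]
  · obtain ⟨b, hb⟩ := exists_eq_sum_diracDeriv (φ := φ₀) (N := 2 * n)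
      (L := (ε * Real.pi / ‖T.fourier n‖) • (T.toLinearMap ∘ₗ circleTranslate (-(φ - φ₀))))
      (fun f hf => by
        have := h.apply_eq_zero_of_iteratedDeriv_eq_zero he h0 (circleTranslate (-(φ - φ₀)) f)
          fun j hj => by
            rw [iteratedDeriv_circleTranslate, show φ + -(φ - φ₀) = φ₀ by ring, hf j hj]
        rw [LinearMap.smul_apply, LinearMap.comp_apply, this, smul_zero])
      (by
        rw [LinearMap.smul_apply, LinearMap.comp_apply, show circleTranslate (-(φ - φ₀)) 1 = 1 from
          rfl, hT1, smul_zero])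
    refine ⟨b, hb, fun k hk => ?_⟩
    rw [Finset.mem_Icc] at hk
    have happ : ∀ f : SmoothCircle, ∑ j ∈ Finset.Icc 1 (2 * n), b j * diracDeriv j φ₀ f
        = ε * Real.pi / ‖T.fourier n‖ * T (circleTranslate (-(φ - φ₀)) f) := fun f => by
      have := LinearMap.congr_fun hb f
      rw [LinearMap.smul_apply, LinearMap.sum_apply] at this
      exact this.symm
    have hsum : ∑ j ∈ Finset.Icc 1 (2 * n),
        (b j : ℂ) * (Complex.I * k) ^ j * Complex.exp (-(Complex.I * k * φ₀))
        = ((ε * Real.pi / ‖T.fourier n‖ : ℝ) : ℂ) * ((E * r) ^ k * T.fourier k) := by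
      have h1 : ∀ j, (b j : ℂ) * (Complex.I * k) ^ j * Complex.exp (-(Complex.I * k * φ₀))
          = ((b j * diracDeriv j φ₀ (re (exp (-k))) : ℝ) : ℂ)
            + Complex.I * ((b j * diracDeriv j φ₀ (im (exp (-k))) : ℝ) : ℂ) := fun j => by
        have := diracDeriv_complexify j k φ₀
        rw [Int.cast_natCast] at this
        push_cast
        rw [mul_assoc, ← this]; ring
      have h2 := complexify_circleTranslate T (φ - φ₀) k
      rw [hrot, zpow_natCast] at h2
      rw [Finset.sum_congr rfl fun j _ => h1 j, Finset.sum_add_distrib, ← Finset.mul_sum,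
        ← Complex.ofReal_sum, ← Complex.ofReal_sum, happ, happ, ← h2]
      push_cast; ring
    rw [hsum]
    split_ifs with hkn
    · subst hkn
      -- The rotated coefficient is real: s cancels against r^n, and A E^n is the sign ε.
      have hEr : (E * r) ^ k * T.fourier k = ‖T.fourier k‖ * ε := by
        conv_lhs => rw [htA]
        rw [mul_pow, hrn, ← hAε]; field_simp
      rw [hEr]
      push_cast
      field_simp
      rw [hεc]
    · rw [hlow k (by omega)]; simp
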